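/- Let $q$ be a prime power and $n=sk+h$ with integers $s\ge 2$, $s\ne 4$ and $0\le h<k$. For $1\le i\le s-1$ let $\mathbf P_i$ be the companion matrix (ones on the superdiagonal, last row $-a_0,-a_1,\dots$) of a primitive polynomial $x^{ik+h}+\cdots+a_1x+a_0$ of degree $ik+h$ over $\mathbb F_q$, and let $G_i\le \mathrm{GL}_n(\mathbb F_q)$ be the cyclic group of the matrices $\mathrm{diag}(\mathbf I_{(s-i-1)k},\mathbf I_k,\mathbf X)$ with $\mathbf X\in\langle \mathbf P_i\rangle$. Write $\mathbf U^{(j)}$ for the matrix of the first $j$ rows of a matrix $\mathbf U$, $\mathbf U^{[j]}$ for the matrix of the remaining rows, and $\mathrm{rs}$ for the row space. Put $$\mathbf A_i=\begin{bmatrix}\mathbf 0&\mathbf I_k&\mathbf I_{ik+h}^{(k)}\\ \mathbf 0&\mathbf 0&\mathbf I_{ik+h}^{[k]}\\ \mathbf I_{(s-i-1)k}&\mathbf 0&\mathbf 0\\ \mathbf 0&\mathbf 0&\mathbf I_{ik+h}^{(k-1)}\end{bmatrix},\qquad \mathbf B_i=\begin{bmatrix}\mathbf 0&\mathbf I_k&\mathbf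 0\\ \mathbf 0&\mathbf 0&\mathbf I_{ik+h}^{[k]}\\ \mathbf I_{(s-i-1)k}&\mathbf 0&\mathbf 0\\ \mathbf 0&\mathbf 0&\mathbf I_{ik+h}^{(k-1)}\end{bmatrix},$$ and let $\mathbf M$ be the $(n-1)\times n$ matrix whose rows are the unit vectors $e_n,e_{n-1},\dots,e_2$. Let $\mathcal W=\{\mathbf A_ig,\ \mathbf B_i,\ \mathbf M: g\in G_i,\ 1\le i\le s-1\}$, let $\mathscr C=\{\mathrm{rs}(\mathbf W):\mathbf W\in\mathcal W\}$, and let $\mathcal C=\{(\mathrm{rs}(\mathbf W^{(1)}),\dots,\mathrm{rs}(\mathbf W^{(n-1)})):\mathbf W\in\mathcal W\}$. Let $r\ge1$ and let $\mathbf t=(t_1<\dots<t_r)$ be a strictly increasing sequence of elements of $$\{1,2,\dots,k+h\}\cup\{jk+h:2\le j\le s-2\}\cup\{n-k,\dots,n-1\},$$ and let $\mathcal C_{\mathbf t}=\{(\mathrm{rs}(\mathbf W^{(t_1)}),\dots,\mathrm{rs}(\mathbf W^{(t_r)})):\mathbf W\in\mathcal W\}$. Then $\mathcal C_{\mathbf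 t}$ is a non-empty set of flags of type $\mathbf t$ on $\mathbb F_q^n$ (strictly increasing sequences of nonzero proper subspaces of dimensions $t_1,\dots,t_r$); it is cardinality-consistent, that is, for each $i$ the set of the $i$-th components of its flags has exactly $|\mathcal C_{\mathbf t}|$ elements; moreover $$|\mathcal C_{\mathbf t}|=|\mathcal C|=|\mathscr C|=\sum_{i=1}^{s-1}q^{ik+h}+1,$$ and the minimum of the flag distance $\sum_{i=1}^r\bigl(\dim(F_i+F_i')-\dim(F_i\cap F_i')\bigr)$ over pairs of distinct flags $(F_i)_i,(F_i')_i\in\mathcal C_{\mathbf t}$ equals $$\sum_{t_i\le k}2t_i\;+\sum_{\substack{t_i\ge n-k\\ t_i>k}}2(n-t_i)\;+\sum_{k<t_i<n-k}2k .$$ -/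

import Mathlib

open Polynomial

namespace FlagCode

section SubspacesAndFlags

variable {F : Type*} [Field F]

/-- Row space of a matrix: the span of its rows. -/
def rowSpace {m n : ℕ} (W : Matrix (Fin m) (Fin n) F) : Submodule F (Fin n → F) :=
  Submodule.span F (Set.range W.row)

/-- Row space of the submatrix of `W` formed by its first `j` rows (rows `0, …, j - 1`). -/
def firstRowsSpace {m n : ℕ} (W : Matrix (Fin m) (Fin n) F) (j : ℕ) :
    Submodule F (Fin n → F) :=
  Submodule.span F (W.row '' {r | (r : ℕ) < j})

/-- The subspace distance `dim (U + V) - dim (U ∩ V)` (the subtraction never truncates). -/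
noncomputable def subspaceDist {n : ℕ} (U V : Submodule F (Fin n → F)) : ℕ :=
  Module.finrank F ↥(U ⊔ V) - Module.finrank F ↥(U ⊓ V)

/-- `𝓕` is a flag of type `t = (t 0, …, t (r - 1))` on `F ^ n`: a strictly increasing sequence of
nonzero proper subspaces of the prescribed dimensions. -/
structure IsFlagOfType {n r : ℕ} (t : Fin r → ℕ) (𝓕 : Fin r → Submodule F (Fin n → F)) :
    Prop where
  bot_lt : ∀ i, ⊥ < 𝓕 i
  strictMono : StrictMono 𝓕
  lt_top : ∀ i, 𝓕 i < ⊤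
  finrank_eq : ∀ i, Module.finrank F (𝓕 i) = t i

/-- A flag code of type `t` on `F ^ n`: a non-empty set of flags of type `t`. -/
structure IsFlagCode {n r : ℕ} (t : Fin r → ℕ)
    (C : Set (Fin r → Submodule F (Fin n → F))) : Prop where
  nonempty : C.Nonempty
  isFlag : ∀ 𝓕 ∈ C, IsFlagOfType t 𝓕

/-- The flag distance: the sum of the subspace distances of the components. -/
noncomputable def flagDist {n r : ℕ} (𝓕 𝓖 : Fin r → Submodule F (Fin n → F)) : ℕ :=
  ∑ i, subspaceDist (𝓕 i) (𝓖 i)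

/-- `d` is the minimum flag distance of `C`: the minimum exists and equals `d`. -/
def HasMinDist {n r : ℕ} (C : Set (Fin r → Submodule F (Fin n → F))) (d : ℕ) : Prop :=
  IsLeast {x : ℕ | ∃ 𝓕 ∈ C, ∃ 𝓖 ∈ C, 𝓕 ≠ 𝓖 ∧ x = flagDist 𝓕 𝓖} d

/-- The `i`-projected code: all `i`-th components of flags in `C`. -/
def projectedCode {n r : ℕ} (C : Set (Fin r → Submodule F (Fin n → F))) (i : Fin r) :
    Set (Submodule F (Fin n → F)) :=
  (fun 𝓕 => 𝓕 i) '' C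

/-- All projected codes have as many elements as the code itself. -/
def IsCardinalityConsistent {n r : ℕ} (C : Set (Fin r → Submodule F (Fin n → F))) : Prop :=
  ∀ i, (projectedCode C i).ncard = C.ncard

/-- The sequence of row spaces of the first `t i` rows of `W`. -/
def flagOf {m n r : ℕ} (t : Fin r → ℕ) (W : Matrix (Fin m) (Fin n) F) :
    Fin r → Submodule F (Fin n → F) :=
  fun i => firstRowsSpace W (t i)

/-- A primitive polynomial of degree `d` over a finite field with `q` elements: a monic irreducible
polynomial of degree `d` whose roots have multiplicative order `q ^ d - 1`, that is, generate the
multiplicative group of the field with `q ^ d` elements. -/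
structure IsPrimitivePoly [Fintype F] (f : F[X]) (d : ℕ) : Prop where
  monic : f.Monic
  irreducible : Irreducible f
  natDegree_eq : f.natDegree = d
  orderOf_root : orderOf (AdjoinRoot.root f) = Fintype.card F ^ d - 1

/-- The companion matrix of a monic polynomial `f = x ^ d + a_{d-1} x ^ (d-1) + ⋯ + a_0`: row `r` is
the unit vector `e_{r+1}` for `r < d - 1`, and the last row is `(-a_0, …, -a_{d-1})`. -/
def companion (f : F[X]) (d : ℕ) : Matrix (Fin d) (Fin d) F :=
  Matrix.of fun r c =>
    if (r : ℕ) + 1 < d then (if (c : ℕ) = r + 1 then 1 else 0) else -f.coeff c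

end SubspacesAndFlags

section Construction

/-! Throughout, `n = s * k + h` and `1 ≤ i ≤ s - 1`. The columns `0, …, n - 1` are divided into three
blocks, of widths `(s - i - 1) * k`, `k` and `i * k + h`; the second block starts at column
`(s - i - 1) * k` and the third at column `(s - i - 1) * k + k`. -/

variable (F : Type*) [Field F] (s k h : ℕ)

/-- The matrix with block rows
`[0, I_k, first k rows of I_{ik+h}]`, `[0, 0, last (i-1)k+h rows of I_{ik+h}]`,
`[I_{(s-i-1)k}, 0, 0]`, `[0, 0, first k-1 rows of I_{ik+h}]`. -/
def matA (i : ℕ) : Matrix (Fin (s * k + h - 1)) (Fin (s * k + h)) F :=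
  Matrix.of fun r c =>
    if (r : ℕ) < k then
      (if (c : ℕ) = (s - i - 1) * k + r ∨ (c : ℕ) = (s - i - 1) * k + k + r then 1 else 0)
    else if (r : ℕ) < i * k + h then
      (if (c : ℕ) = (s - i - 1) * k + k + r then 1 else 0)
    else if (r : ℕ) < i * k + h + (s - i - 1) * k then
      (if (c : ℕ) = r - (i * k + h) then 1 else 0)
    else
      (if (c : ℕ) = (s - i - 1) * k + k + (r - (i * k + h + (s - i - 1) * k)) then 1 else 0)

/-- The matrix with block rows
`[0, I_k, 0]`, `[0, 0, last (i-1)k+h rows of I_{ik+h}]`,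
`[I_{(s-i-1)k}, 0, 0]`, `[0, 0, first k-1 rows of I_{ik+h}]`. -/
def matB (i : ℕ) : Matrix (Fin (s * k + h - 1)) (Fin (s * k + h)) F :=
  Matrix.of fun r c =>
    if (r : ℕ) < k then
      (if (c : ℕ) = (s - i - 1) * k + r then 1 else 0)
    else if (r : ℕ) < i * k + h then
      (if (c : ℕ) = (s - i - 1) * k + k + r then 1 else 0)
    else if (r : ℕ) < i * k + h + (s - i - 1) * k then
      (if (c : ℕ) = r - (i * k + h) then 1 else 0)
    else
      (if (c : ℕ) = (s - i - 1) * k + k + (r - (i * k + h + (s - i - 1) * k)) then 1 else 0)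

/-- The `(n-1) × n` matrix whose rows are, in this order, the unit vectors
`e_{n-1}, e_{n-2}, …, e_1` (columns numbered from `0`). -/
def matM : Matrix (Fin (s * k + h - 1)) (Fin (s * k + h)) F :=
  Matrix.of fun r c => if (r : ℕ) + c + 1 = s * k + h then 1 else 0

variable {F}

/-- The block diagonal matrix `diag (I_{(s-i-1)k}, I_k, X)` of size `n × n`. (Row and column indices
from `(s-i-1)k + k` on are exactly those of the last block, so that the first two conditions
below, which bound the arguments of `X`, then hold automatically.) -/
def blockDiag (i : ℕ) (X : Matrix (Fin (i * k + h)) (Fin (i * k + h)) F) :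
    Matrix (Fin (s * k + h)) (Fin (s * k + h)) F :=
  Matrix.of fun r c =>
    if H : (r : ℕ) - ((s - i - 1) * k + k) < i * k + h ∧
        (c : ℕ) - ((s - i - 1) * k + k) < i * k + h ∧
        (s - i - 1) * k + k ≤ (r : ℕ) ∧ (s - i - 1) * k + k ≤ (c : ℕ) then
      X ⟨(r : ℕ) - ((s - i - 1) * k + k), H.1⟩ ⟨(c : ℕ) - ((s - i - 1) * k + k), H.2.1⟩
    else if r = c then 1 else 0

/-- The cyclic group of all `diag (I_{(s-i-1)k}, I_k, X)` with `X` in the cyclic group generated by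
the companion matrix of `f`, as a set of matrices. (The companion matrix of a primitive polynomial
has finite multiplicative order, so that its nonnegative powers are all its powers.) -/
def groupG (i : ℕ) (f : F[X]) : Set (Matrix (Fin (s * k + h)) (Fin (s * k + h)) F) :=
  {g | ∃ X ∈ Submonoid.powers (companion f (i * k + h)), g = blockDiag s k h i X}

/-- The generator matrices `A_i g` (`g ∈ G_i`), `B_i` (`1 ≤ i ≤ s - 1`) and `M`; `f i` is the
polynomial whose companion matrix generates `G_i`. -/
def generators (f : ℕ → F[X]) : Set (Matrix (Fin (s * k + h - 1)) (Fin (s * k + h)) F) :=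
  {W | (∃ i, 1 ≤ i ∧ i ≤ s - 1 ∧
      ((∃ g ∈ groupG s k h i (f i), W = matA F s k h i * g) ∨ W = matB F s k h i)) ∨
    W = matM F s k h}

/-- The subspace code of the row spaces of the generator matrices. -/
def subspaceCode (f : ℕ → F[X]) : Set (Submodule F (Fin (s * k + h) → F)) :=
  rowSpace '' generators s k h f

/-- The code `C_t`, consisting of the sequences `(W^(t_1), …, W^(t_r))` for the generator matrices
`W`, where `W^(j)` is the row space of the first `j` rows of `W`. -/
def flagCode (f : ℕ → F[X]) {r : ℕ} (t : Fin r → ℕ) :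
    Set (Fin r → Submodule F (Fin (s * k + h) → F)) :=
  flagOf t '' generators s k h f

/-- The full flag code, of type `(1, 2, …, n - 1)`. -/
def fullFlagCode (f : ℕ → F[X]) :
    Set (Fin (s * k + h - 1) → Submodule F (Fin (s * k + h) → F)) :=
  flagCode s k h f (fun j => (j : ℕ) + 1)

/-- The dimensions `1, …, k + h, 2k + h, …, (s - 2)k + h, n - k, …, n - 1`. -/
def longType : Set ℕ :=
  {d | (1 ≤ d ∧ d ≤ k + h) ∨ (∃ j, 2 ≤ j ∧ j ≤ s - 2 ∧ d = j * k + h) ∨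
    (s * k + h - k ≤ d ∧ d ≤ s * k + h - 1)}

end Construction

end FlagCode

open FlagCode

/-! Everything rests on one estimate, `finrank_inf_genMatrix_le`: if t ≤ k + h or t = jk + h with 2
≤ j ≤ s - 1, and U, V are spanned by the first t rows of two different generator matrices, then dim
(U ∩ V) ≤ t - k (zero for t ≤ k). Both spaces have dimension t, so their distance is at least 2t for
t ≤ k and at least 2k otherwise. For t = n - k the estimate gives dim (U + V) ≥ 2(n - k) - (n - 2k)
= n; hence U + V is the whole space there and in all larger dimensions, where the distance is
therefore 2(n - t). A single pair, `A_{s-1}` and `B_{s-1}`, which differ only in their first k rows,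
attains all these bounds at once. Since the bounds are positive, any one component determines the
generator matrix, so every cardinality is the number of indices: one for `M` and, for each i, the
q^(ik+h) - 1 powers of the companion matrix together with `B_i`.

For the estimate, put d = ik + h. A combination of the first t ≤ n - k rows of `A_i g` or `B_i` has
the form (a, first k entries of b, bZ), where a is supported on the first t - d entries, b on the
first t, and Z is either an invertible X or diag(0, I); this is `shapeSpace`. For equal i,
differences of distinct powers of the companion matrix are invertible, and a common vector depends
on t - k parameters only (`finrank_inf_le_of_separated`). For i < i' and t ≤ d, the zeros of U cover
the middle block of V. For i < i' and t = jk + h > d, U contains the first t - d unit vectors, and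
in general k consecutive ones among them span a space that meets V trivially
(`finrank_inf_le_of_gt`). The exceptions have V from `B_{i'}` and i' = i + 1 or j = i + 1; they are
counted directly. Only there is s ≠ 4 needed, to exclude i = 1, j = 2, i' = 3. The matrix `M` is
treated through the zeros in its first n - t columns. -/

namespace FlagCode

/-! ### Powers of a primitive companion matrix inside a field of matrices. -/

section Companion

variable {F : Type*} [Field F]

/-- Multiplication by the root shifts the power basis and expands the top power through the
coefficients of `f`. `leftMulMatrix` stores these images in columns, hence the transpose. -/
theorem companion_eq_transpose_leftMulMatrix (f : F[X]) (hf : f.Monic) :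
    companion f f.natDegree =
      (Algebra.leftMulMatrix (AdjoinRoot.powerBasis hf.ne_zero).basis (AdjoinRoot.root f)).transpose := by
  have h := (AdjoinRoot.powerBasis hf.ne_zero).leftMulMatrix
  have hg : (AdjoinRoot.powerBasis hf.ne_zero).minpolyGen = f := by
    rw [PowerBasis.minpolyGen_eq, AdjoinRoot.minpoly_powerBasis_gen_of_monic hf]
  rw [AdjoinRoot.powerBasis_gen] at h
  rw [h, hg]
  ext r c
  have hr : (r : ℕ) < f.natDegree := r.2
  change (if (r : ℕ) + 1 < f.natDegree then (if (c : ℕ) = r + 1 then 1 else 0) else -f.coeff c) =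
    (if (r : ℕ) + 1 = f.natDegree then -f.coeff c else if (c : ℕ) = r + 1 then (1 : F) else 0)
  split_ifs <;> first | rfl | omega

/-- The companion matrix of an irreducible polynomial generates a copy of the root field. -/
theorem exists_ringHom_root_eq_companion (f : F[X]) (d : ℕ) (hm : f.Monic) (hd : f.natDegree = d) :
    ∃ φ : AdjoinRoot f →+* Matrix (Fin d) (Fin d) F, φ (AdjoinRoot.root f) = companion f d := by
  subst hd
  refine ⟨{ toFun := fun a =>
              (Algebra.leftMulMatrix (AdjoinRoot.powerBasis hm.ne_zero).basis a).transpose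
            map_one' := ?_, map_mul' := ?_, map_zero' := ?_, map_add' := ?_ }, ?_⟩
  · rw [map_one]; exact Matrix.transpose_one
  · intro a b
    -- Transposition reverses products; commutativity of `AdjoinRoot f` compensates.
    rw [mul_comm, map_mul]; exact Matrix.transpose_mul _ _
  · rw [map_zero]; rfl
  · intro a b
    rw [map_add]; rfl
  · exact (companion_eq_transpose_leftMulMatrix f hm).symm

variable [Fintype F] {f : F[X]} {d : ℕ}

theorem IsPrimitivePoly.card_powers_companion (hf : IsPrimitivePoly f d) (hd : 0 < d) :
    Nat.card (Submonoid.powers (companion f d)) = Fintype.card F ^ d - 1 := by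
  have : Fact (Irreducible f) := ⟨hf.irreducible⟩
  -- Positive size makes the matrix ring nontrivial, so that `φ` is injective on the field and
  -- preserves orders.
  have : Nonempty (Fin d) := ⟨⟨0, hd⟩⟩
  obtain ⟨φ, hφ⟩ := exists_ringHom_root_eq_companion f d hf.monic hf.natDegree_eq
  have ho : orderOf (companion f d) = Fintype.card F ^ d - 1 := by
    rw [← hφ, ← hf.orderOf_root]
    exact orderOf_injective φ.toMonoidHom φ.injective _
  have hq : 1 < Fintype.card F ^ d := Nat.one_lt_pow hd.ne' Fintype.one_lt_card
  rw [← Nat.card_congr (finEquivPowers (orderOf_pos_iff.mp (by omega))), Nat.card_fin, ho]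

/-- Irreducibility alone allows the root to be zero (`f = X`); its positive order excludes this. -/
theorem IsPrimitivePoly.isUnit_of_mem_powers (hf : IsPrimitivePoly f d) (hd : 0 < d)
    {X : Matrix (Fin d) (Fin d) F} (hX : X ∈ Submonoid.powers (companion f d)) : IsUnit X := by
  have : Fact (Irreducible f) := ⟨hf.irreducible⟩
  obtain ⟨φ, hφ⟩ := exists_ringHom_root_eq_companion f d hf.monic hf.natDegree_eq
  obtain ⟨m, rfl⟩ := hX
  have h0 : AdjoinRoot.root f ≠ 0 := by
    intro h0
    have h := hf.orderOf_root
    have hq : 1 < Fintype.card F ^ d := Nat.one_lt_pow hd.ne' Fintype.one_lt_card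
    rw [h0] at h
    have h1 := pow_orderOf_eq_one (0 : AdjoinRoot f)
    rw [h, zero_pow (by omega)] at h1
    exact zero_ne_one h1
  change IsUnit (companion f d ^ m)
  rw [← hφ]
  exact ((isUnit_iff_ne_zero.mpr h0).map φ).pow m

/-- The powers lie in the image of a field, where a nonzero difference is invertible. This separates
the matrices `A_i g` with the same i. -/
theorem IsPrimitivePoly.isUnit_sub_of_mem_powers (hf : IsPrimitivePoly f d)
    {X Y : Matrix (Fin d) (Fin d) F} (hX : X ∈ Submonoid.powers (companion f d))
    (hY : Y ∈ Submonoid.powers (companion f d)) (hXY : X ≠ Y) : IsUnit (X - Y) := by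
  have : Fact (Irreducible f) := ⟨hf.irreducible⟩
  obtain ⟨φ, hφ⟩ := exists_ringHom_root_eq_companion f d hf.monic hf.natDegree_eq
  obtain ⟨m, rfl⟩ := hX
  obtain ⟨l, rfl⟩ := hY
  have h : AdjoinRoot.root f ^ m - AdjoinRoot.root f ^ l ≠ 0 := by
    intro h
    apply hXY
    change companion f d ^ m = companion f d ^ l
    rw [← hφ, ← map_pow, ← map_pow, sub_eq_zero.mp h]
  have := (isUnit_iff_ne_zero.mpr h).map φ
  rwa [map_sub, map_pow, map_pow, hφ] at this

end Companion

/-! ### Dimension bounds from functionals and from windows of unit vectors. -/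

section Dimension

variable {F : Type*} [Field F] {n : ℕ}

/-- If the common zero set of `m` functionals meets `S` trivially, then `dim S ≤ m`. -/
theorem finrank_le_of_functionals {V : Type*} [AddCommGroup V] [Module F V] (S : Submodule F V)
    {m : ℕ} (φ : ℕ → V →ₗ[F] F) (h : ∀ v ∈ S, (∀ j < m, φ j v = 0) → v = 0) :
    Module.finrank F S ≤ m := by
  have hinj : Function.Injective
      ((LinearMap.pi fun j : Fin m => φ j : V →ₗ[F] Fin m → F).comp S.subtype) := by
    rw [← LinearMap.ker_eq_bot, LinearMap.ker_eq_bot']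
    intro v hv
    refine Subtype.ext (h v v.2 fun j hj => ?_)
    exact congrFun hv ⟨j, hj⟩
  simpa using LinearMap.finrank_le_finrank_of_injective hinj

/-- A subspace `E` of `U` that meets `V` trivially bounds the dimension of `U ⊓ V`. -/
theorem finrank_inf_add_le {U V E : Submodule F (Fin n → F)} (hE : E ≤ U) (hEV : E ⊓ V = ⊥) :
    Module.finrank F ↥(U ⊓ V) + Module.finrank F E ≤ Module.finrank F U := by
  have h1 : (U ⊓ V) ⊓ E = ⊥ := by
    rw [eq_bot_iff, ← hEV]
    exact le_inf inf_le_right (inf_le_left.trans inf_le_right)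
  have h2 := Submodule.finrank_sup_add_finrank_inf_eq (U ⊓ V) E
  rw [h1, finrank_bot, add_zero] at h2
  rw [← h2]
  exact Submodule.finrank_mono (sup_le inf_le_left hE)

/-- The `c`-th coordinate, zero outside of the range `c < n`. -/
def coord (n c : ℕ) : (Fin n → F) →ₗ[F] F :=
  if h : c < n then LinearMap.proj ⟨c, h⟩ else 0

theorem coord_of_lt {c : ℕ} (h : c < n) (v : Fin n → F) : coord n c v = v ⟨c, h⟩ := by
  simp [coord, h]

theorem coord_of_le {c : ℕ} (h : n ≤ c) (v : Fin n → F) : coord n c v = 0 := by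
  simp [coord, h.not_gt]

theorem eq_zero_of_coord {v : Fin n → F} (h : ∀ c < n, coord n c v = 0) : v = 0 := by
  ext c
  simpa [coord_of_lt c.2] using h c c.2

/-- The `d` coordinates from the `p`-th on. -/
def segment (n p d : ℕ) : (Fin n → F) →ₗ[F] (Fin d → F) :=
  LinearMap.pi fun r => coord n (p + r)

@[simp]
theorem segment_apply (p d : ℕ) (v : Fin n → F) (r : Fin d) :
    segment n p d v r = coord n (p + r) v := rfl

/-- If `U` contains the unit vectors `e_a, …, e_{a+k-1}` and `V` meets their span trivially, then
`dim (U ⊓ V) ≤ dim U - k`. -/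
theorem finrank_inf_le_of_coord {U V : Submodule F (Fin n → F)} {a k : ℕ} (hak : a + k ≤ n)
    (hU : ∀ c : Fin n, a ≤ c → (c : ℕ) < a + k → Pi.single c 1 ∈ U)
    (hV : ∀ v ∈ V, (∀ c, (c < a ∨ a + k ≤ c) → coord n c v = 0) → v = 0) :
    Module.finrank F ↥(U ⊓ V) ≤ Module.finrank F U - k := by
  let e : Fin k → (Fin n → F) := fun j => Pi.single ⟨a + j, by omega⟩ 1
  have he : LinearIndependent F e :=
    (Pi.linearIndependent_single_one (Fin n) F).comp (fun j : Fin k => (⟨a + j, by omega⟩ : Fin n))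
      fun i j hij => by simpa [Fin.ext_iff] using hij
  have hE : Submodule.span F (Set.range e) ≤ U := by
    rw [Submodule.span_le]
    rintro _ ⟨j, rfl⟩
    exact hU _ (by simp) (by simp)
  have hcoord : ∀ v ∈ Submodule.span F (Set.range e), ∀ c, (c < a ∨ a + k ≤ c) →
      coord n c v = 0 := by
    intro v hv c hc
    induction hv using Submodule.span_induction with
    | mem x hx =>
      obtain ⟨j, rfl⟩ := hx
      rcases lt_or_ge c n with hcn | hcn
      · rw [coord_of_lt hcn]
        refine Pi.single_eq_of_ne ?_ _
        simp only [ne_eq, Fin.mk.injEq]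
        have := j.2
        omega
      · exact coord_of_le hcn _
    | zero => simp
    | add x y _ _ hx hy => rw [map_add, hx, hy, add_zero]
    | smul r x _ hx => rw [map_smul, hx, smul_zero]
  have hEV : Submodule.span F (Set.range e) ⊓ V = ⊥ := by
    rw [eq_bot_iff]
    rintro v ⟨h1, h2⟩
    exact hV v h2 (hcoord v h1)
  have := finrank_inf_add_le hE hEV
  rw [finrank_span_eq_card he, Fintype.card_fin] at this
  omega

end Dimension

/-! ### Spans of initial rows. -/

section FirstRows

variable {F : Type*} [Field F] {m n : ℕ}

theorem firstRowsSpace_mono (W : Matrix (Fin m) (Fin n) F) {a b : ℕ} (hab : a ≤ b) :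
    firstRowsSpace W a ≤ firstRowsSpace W b :=
  Submodule.span_mono (Set.image_mono fun _ hr => lt_of_lt_of_le hr hab)

theorem row_mem_firstRowsSpace (W : Matrix (Fin m) (Fin n) F) {r : Fin m} {t : ℕ}
    (hr : (r : ℕ) < t) : W.row r ∈ firstRowsSpace W t :=
  Submodule.subset_span ⟨r, hr, rfl⟩

theorem rowSpace_eq_firstRowsSpace (W : Matrix (Fin m) (Fin n) F) :
    rowSpace W = firstRowsSpace W m := by
  rw [rowSpace, firstRowsSpace, ← Set.image_univ]
  congr 2
  ext r
  simp

theorem finrank_firstRowsSpace {W : Matrix (Fin m) (Fin n) F} (hW : LinearIndependent F W.row)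
    {t : ℕ} (ht : t ≤ m) : Module.finrank F (firstRowsSpace W t) = t := by
  have h : W.row '' {r | (r : ℕ) < t} = Set.range (W.row ∘ Fin.castLE ht) := by
    ext v
    constructor
    · rintro ⟨r, hr, rfl⟩
      exact ⟨⟨r, hr⟩, rfl⟩
    · rintro ⟨r, rfl⟩
      exact ⟨Fin.castLE ht r, by simp, rfl⟩
  rw [firstRowsSpace, h, finrank_span_eq_card (hW.comp _ (Fin.castLE_injective ht)),
    Fintype.card_fin]

/-- Common rows give a lower bound for the dimension of the intersection. -/
theorem le_finrank_inf_of_row_eq {W W' : Matrix (Fin m) (Fin n) F}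
    (hW : LinearIndependent F W.row) {a t : ℕ} (ht : t ≤ m)
    (h : ∀ r : Fin m, a ≤ r → (r : ℕ) < t → W.row r = W'.row r) :
    t - a ≤ Module.finrank F ↥(firstRowsSpace W t ⊓ firstRowsSpace W' t) := by
  let e : Fin (t - a) → Fin m := fun j => ⟨a + j, by omega⟩
  have he : LinearIndependent F (W.row ∘ e) :=
    hW.comp e fun i j hij => by simpa [e, Fin.ext_iff] using hij
  have hle : Submodule.span F (Set.range (W.row ∘ e)) ≤
      firstRowsSpace W t ⊓ firstRowsSpace W' t := by
    rw [Submodule.span_le]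
    rintro _ ⟨j, rfl⟩
    have hj : ((e j : Fin m) : ℕ) < t := by simp only [e]; omega
    refine ⟨row_mem_firstRowsSpace W hj, ?_⟩
    change W.row (e j) ∈ firstRowsSpace W' t
    rw [h (e j) (by simp [e]) hj]
    exact row_mem_firstRowsSpace W' hj
  have := Submodule.finrank_mono hle
  rwa [finrank_span_eq_card he, Fintype.card_fin] at this

theorem linearIndependent_of_dual {V : Type*} [AddCommGroup V] [Module F V] {w : Fin m → V}
    (ψ : Fin m → V →ₗ[F] F) (h : ∀ r r', ψ r (w r') = if r' = r then 1 else 0) :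
    LinearIndependent F w := by
  rw [Fintype.linearIndependent_iff]
  intro a ha r
  have := congrArg (ψ r) ha
  simpa [h] using this

end FirstRows

/-! ### The common shape of the row spaces. -/

section Shape

variable {F : Type*} [Field F]

/-- The vectors `v` that vanish on the columns `t - d, …, O - 1` and for which some `b : F ^ d`,
supported on the first `t` entries, agrees with `v` on the `k` columns from `O` on, while the `d`
columns from `O + k` on carry `b * Z`. -/
def shapeSpace (n O k d t : ℕ) (Z : Matrix (Fin d) (Fin d) F) : Submodule F (Fin n → F) where
  carrier := {v | (∀ c, t - d ≤ c → c < O → coord n c v = 0) ∧ ∃ b : Fin d → F,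
    (∀ r : Fin d, t ≤ r → b r = 0) ∧ (∀ r : Fin d, (r : ℕ) < k → coord n (O + r) v = b r) ∧
    segment n (O + k) d v = Matrix.vecMul b Z}
  add_mem' := by
    rintro v w ⟨hv, b, hb, hvb, hvZ⟩ ⟨hw, b', hb', hwb, hwZ⟩
    refine ⟨fun c h1 h2 => by rw [map_add, hv c h1 h2, hw c h1 h2, add_zero], b + b',
      fun r hr => by rw [Pi.add_apply, hb r hr, hb' r hr, add_zero],
      fun r hr => by rw [map_add, hvb r hr, hwb r hr, Pi.add_apply], ?_⟩
    rw [map_add, hvZ, hwZ, Matrix.add_vecMul]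
  zero_mem' := ⟨fun c _ _ => map_zero _, 0, fun _ _ => rfl, fun _ _ => by simp, by simp⟩
  smul_mem' := by
    rintro a v ⟨hv, b, hb, hvb, hvZ⟩
    refine ⟨fun c h1 h2 => by rw [map_smul, hv c h1 h2, smul_zero], a • b,
      fun r hr => by rw [Pi.smul_apply, hb r hr, smul_zero],
      fun r hr => by rw [map_smul, hvb r hr, Pi.smul_apply], ?_⟩
    rw [map_smul, hvZ, Matrix.smul_vecMul]

/-- The diagonal matrix `diag (0_k, I)`. -/
def truncation (F : Type*) [Field F] (k d : ℕ) : Matrix (Fin d) (Fin d) F :=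
  Matrix.diagonal fun r => if (r : ℕ) < k then 0 else 1

theorem vecMul_truncation (k d : ℕ) (b : Fin d → F) (r : Fin d) :
    Matrix.vecMul b (truncation F k d) r = if (r : ℕ) < k then 0 else b r := by
  rw [truncation, Matrix.vecMul_diagonal]
  split_ifs <;> simp

end Shape

/-! ### The generator matrices: independence of rows, shape, unit vectors. -/

section Generators

variable {F : Type*} [Field F] {s k h i : ℕ}

theorem width_add (hi : i + 1 ≤ s) : (s - i - 1) * k + k + (i * k + h) = s * k + h := by
  obtain ⟨e, rfl⟩ := Nat.exists_eq_add_of_le hi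
  rw [show i + 1 + e - i - 1 = e by omega]
  ring

theorem coord_vecMul_blockDiag (X : Matrix (Fin (i * k + h)) (Fin (i * k + h)) F)
    (v : Fin (s * k + h) → F) {c : ℕ} (hc : c < (s - i - 1) * k + k) :
    coord (s * k + h) c (Matrix.vecMul v (blockDiag s k h i X)) = coord (s * k + h) c v := by
  rcases lt_or_ge c (s * k + h) with hcn | hcn
  · rw [coord_of_lt hcn, coord_of_lt hcn, Matrix.vecMul, dotProduct]
    have : ∀ r : Fin (s * k + h), blockDiag s k h i X r ⟨c, hcn⟩ = if r = ⟨c, hcn⟩ then 1 else 0 := by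
      intro r
      rw [blockDiag, Matrix.of_apply, dif_neg]
      rintro ⟨-, -, -, h4⟩
      exact absurd h4 hc.not_ge
    simp [this]
  · rw [coord_of_le hcn, coord_of_le hcn]

theorem segment_vecMul_blockDiag (hi : i + 1 ≤ s)
    (X : Matrix (Fin (i * k + h)) (Fin (i * k + h)) F) (v : Fin (s * k + h) → F) :
    segment (s * k + h) ((s - i - 1) * k + k) (i * k + h)
        (Matrix.vecMul v (blockDiag s k h i X)) =
      Matrix.vecMul (segment (s * k + h) ((s - i - 1) * k + k) (i * k + h) v) X := by
  have hn := width_add (k := k) (h := h) hi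
  ext c
  have hc : (s - i - 1) * k + k + c < s * k + h := by have := c.2; omega
  rw [segment_apply, coord_of_lt hc, Matrix.vecMul, Matrix.vecMul, dotProduct, dotProduct,
    ← (finCongr hn).sum_comp, Fin.sum_univ_add]
  rw [Finset.sum_eq_zero, zero_add]
  · refine Finset.sum_congr rfl fun r _ => ?_
    have hr : (s - i - 1) * k + k + r < s * k + h := by have := r.2; omega
    rw [segment_apply, coord_of_lt hr]
    congr 1
    rw [blockDiag, Matrix.of_apply, dif_pos]
    · congr 1 <;> ext <;> simp
    · simp
  · intro r _
    have hr := r.2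
    rw [blockDiag, Matrix.of_apply, dif_neg, if_neg, mul_zero]
    · simp only [Fin.ext_iff, finCongr_apply, Fin.val_cast, Fin.val_castAdd]
      omega
    · rintro ⟨-, -, h3, -⟩
      simp only [finCongr_apply, Fin.val_cast, Fin.val_castAdd] at h3
      omega

theorem eq_of_coord_of_segment (hi : i + 1 ≤ s) {v w : Fin (s * k + h) → F}
    (h1 : ∀ c < (s - i - 1) * k + k, coord (s * k + h) c v = coord (s * k + h) c w)
    (h2 : segment (s * k + h) ((s - i - 1) * k + k) (i * k + h) v =
      segment (s * k + h) ((s - i - 1) * k + k) (i * k + h) w) : v = w := by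
  have hn := width_add (k := k) (h := h) hi
  ext c
  have hc := c.2
  rw [← coord_of_lt c.2 v, ← coord_of_lt c.2 w]
  rcases lt_or_ge (c : ℕ) ((s - i - 1) * k + k) with hcn | hcn
  · exact h1 c hcn
  · have := congrFun h2 ⟨c - ((s - i - 1) * k + k), by omega⟩
    simpa only [segment_apply, Nat.add_sub_cancel' hcn] using this

theorem linearIndependent_row_matA (hi : i + 1 ≤ s) (hk : 0 < k) (hik : 1 ≤ i) :
    LinearIndependent F (matA F s k h i).row := by
  have hn := width_add (k := k) (h := h) hi
  have hki : k ≤ i * k := Nat.le_mul_of_pos_left k hik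
  -- Each functional reads a pivot column. The first k rows have a second 1 in the last block; the
  -- functionals for the last k - 1 rows cancel it by subtracting the matching middle entry.
  refine linearIndependent_of_dual (fun r =>
    if (r : ℕ) < k then coord _ ((s - i - 1) * k + r)
    else if (r : ℕ) < i * k + h then coord _ ((s - i - 1) * k + k + r)
    else if (r : ℕ) < i * k + h + (s - i - 1) * k then coord _ (r - (i * k + h))
    else coord _ ((s - i - 1) * k + k + (r - (i * k + h + (s - i - 1) * k))) -
      coord _ ((s - i - 1) * k + (r - (i * k + h + (s - i - 1) * k)))) fun r r' => ?_
  have hr := r.2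
  have hr' := r'.2
  have hv : ∀ c < s * k + h, coord (s * k + h) c ((matA F s k h i).row r') =
    if (r' : ℕ) < k then
      (if c = (s - i - 1) * k + r' ∨ c = (s - i - 1) * k + k + r' then 1 else 0)
    else if (r' : ℕ) < i * k + h then
      (if c = (s - i - 1) * k + k + r' then 1 else 0)
    else if (r' : ℕ) < i * k + h + (s - i - 1) * k then
      (if c = r' - (i * k + h) then 1 else 0)
    else
      (if c = (s - i - 1) * k + k + (r' - (i * k + h + (s - i - 1) * k)) then 1 else 0) :=
    fun c hc => coord_of_lt hc _
  simp only [Fin.ext_iff]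
  split_ifs with h1 h2 h3 h4 h5 h6 h7 <;> (try rw [LinearMap.sub_apply]) <;>
    (repeat rw [hv _ (by omega)]) <;> split_ifs <;> first | omega | simp

theorem linearIndependent_row_matB (hi : i + 1 ≤ s) (hk : 0 < k) (hik : 1 ≤ i) :
    LinearIndependent F (matB F s k h i).row := by
  have hn := width_add (k := k) (h := h) hi
  have hki : k ≤ i * k := Nat.le_mul_of_pos_left k hik
  refine linearIndependent_of_dual (fun r =>
    if (r : ℕ) < k then coord _ ((s - i - 1) * k + r)
    else if (r : ℕ) < i * k + h then coord _ ((s - i - 1) * k + k + r)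
    else if (r : ℕ) < i * k + h + (s - i - 1) * k then coord _ (r - (i * k + h))
    else coord _ ((s - i - 1) * k + k + (r - (i * k + h + (s - i - 1) * k)))) fun r r' => ?_
  have hr := r.2
  have hr' := r'.2
  have hv : ∀ c < s * k + h, coord (s * k + h) c ((matB F s k h i).row r') =
    if (r' : ℕ) < k then
      (if c = (s - i - 1) * k + r' then 1 else 0)
    else if (r' : ℕ) < i * k + h then
      (if c = (s - i - 1) * k + k + r' then 1 else 0)
    else if (r' : ℕ) < i * k + h + (s - i - 1) * k then
      (if c = r' - (i * k + h) then 1 else 0)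
    else
      (if c = (s - i - 1) * k + k + (r' - (i * k + h + (s - i - 1) * k)) then 1 else 0) :=
    fun c hc => coord_of_lt hc _
  simp only [Fin.ext_iff]
  split_ifs <;> rw [hv _ (by omega)] <;> split_ifs <;> first | omega | simp

theorem linearIndependent_row_matM : LinearIndependent F (matM F s k h).row := by
  refine linearIndependent_of_dual (fun r => coord _ (s * k + h - 1 - r)) fun r r' => ?_
  have hr := r.2
  have hr' := r'.2
  rw [coord_of_lt (by omega)]
  simp only [matM, Matrix.row, Matrix.of_apply, Fin.ext_iff]
  split_ifs <;> first | rfl | omega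

theorem linearIndependent_row_matA_mul (hi : i + 1 ≤ s) (hk : 0 < k) (hik : 1 ≤ i)
    {X : Matrix (Fin (i * k + h)) (Fin (i * k + h)) F} (hX : IsUnit X) :
    LinearIndependent F (matA F s k h i * blockDiag s k h i X).row := by
  have h1 : LinearMap.ker (Matrix.vecMulLinear (blockDiag s k h i X)) = ⊥ := by
    rw [LinearMap.ker_eq_bot']
    intro v hv
    replace hv : Matrix.vecMul v (blockDiag s k h i X) = 0 := hv
    refine eq_of_coord_of_segment hi (fun c hc => ?_) ?_
    · rw [← coord_vecMul_blockDiag X v hc, hv]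
    · refine Matrix.vecMul_injective_of_isUnit hX ?_
      change Matrix.vecMul _ X = Matrix.vecMul _ X
      rw [← segment_vecMul_blockDiag hi, hv, map_zero, Matrix.zero_vecMul]
  have h2 : (matA F s k h i * blockDiag s k h i X).row =
      Matrix.vecMulLinear (blockDiag s k h i X) ∘ (matA F s k h i).row := by
    funext r
    rw [Function.comp_apply, Matrix.vecMulLinear_apply]
    rfl
  have h3 := linearIndependent_row_matA (F := F) (h := h) hi hk hik
  rw [h2]
  generalize (matA F s k h i).row = w at h3 ⊢
  exact h3.map' _ h1

theorem segment_row_matA (hi : i + 1 ≤ s) (hik : 1 ≤ i) (r : Fin (s * k + h - 1)) (c : Fin (i * k + h))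
    (hr : (r : ℕ) < i * k + h + (s - i - 1) * k) :
    segment (s * k + h) ((s - i - 1) * k + k) (i * k + h) ((matA F s k h i).row r) c =
      if (c : ℕ) = r then 1 else 0 := by
  have hn := width_add (k := k) (h := h) hi
  have hki : k ≤ i * k := Nat.le_mul_of_pos_left k hik
  have hc := c.2
  rw [segment_apply, coord_of_lt (by omega)]
  simp only [matA, Matrix.row, Matrix.of_apply]
  split_ifs <;> first | rfl | omega

/-- The bound on t excludes the last k - 1 rows, which repeat identity rows in the last block
without the matching middle entries. -/
theorem firstRowsSpace_matA_mul_le (hi : i + 1 ≤ s) (hik : 1 ≤ i)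
    (X : Matrix (Fin (i * k + h)) (Fin (i * k + h)) F) {t : ℕ}
    (ht : t ≤ i * k + h + (s - i - 1) * k) :
    firstRowsSpace (matA F s k h i * blockDiag s k h i X) t ≤
      shapeSpace (s * k + h) ((s - i - 1) * k) k (i * k + h) t X := by
  have hn := width_add (k := k) (h := h) hi
  have hki : k ≤ i * k := Nat.le_mul_of_pos_left k hik
  rw [firstRowsSpace, Submodule.span_le]
  rintro _ ⟨r, hr, rfl⟩
  simp only [Set.mem_ofPred_eq] at hr
  have hrow : (matA F s k h i * blockDiag s k h i X).row r =
    Matrix.vecMul ((matA F s k h i).row r) (blockDiag s k h i X) := rfl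
  rw [hrow]
  -- The vector b is the indicator of r. It is zero for r ≥ ik + h, where the row is a unit vector
  -- of the first block at a column below t - (ik + h).
  refine ⟨fun c h1 h2 => ?_, fun c => if (c : ℕ) = r then 1 else 0, fun c hc => ?_, fun c hc => ?_, ?_⟩
  · rw [coord_vecMul_blockDiag X _ (by omega), coord_of_lt (by omega)]
    simp only [matA, Matrix.row, Matrix.of_apply]
    split_ifs <;> first | rfl | omega
  · exact if_neg (by omega)
  · rw [coord_vecMul_blockDiag X _ (by omega), coord_of_lt (by omega)]
    simp only [matA, Matrix.row, Matrix.of_apply]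
    split_ifs <;> first | rfl | omega
  · rw [segment_vecMul_blockDiag hi]
    congr 1
    ext c
    exact segment_row_matA hi hik r c (by omega)

theorem firstRowsSpace_matB_le (hi : i + 1 ≤ s) (hik : 1 ≤ i) {t : ℕ}
    (ht : t ≤ i * k + h + (s - i - 1) * k) :
    firstRowsSpace (matB F s k h i) t ≤
      shapeSpace (s * k + h) ((s - i - 1) * k) k (i * k + h) t (truncation F k (i * k + h)) := by
  have hn := width_add (k := k) (h := h) hi
  have hki : k ≤ i * k := Nat.le_mul_of_pos_left k hik
  rw [firstRowsSpace, Submodule.span_le]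
  rintro _ ⟨r, hr, rfl⟩
  simp only [Set.mem_ofPred_eq] at hr
  refine ⟨fun c h1 h2 => ?_, fun c => if (c : ℕ) = r then 1 else 0, fun c hc => ?_, fun c hc => ?_, ?_⟩
  · rw [coord_of_lt (by omega)]
    simp only [matB, Matrix.row, Matrix.of_apply]
    split_ifs <;> first | rfl | omega
  · exact if_neg (by omega)
  · rw [coord_of_lt (by omega)]
    simp only [matB, Matrix.row, Matrix.of_apply]
    split_ifs <;> first | rfl | omega
  · ext c
    have hc := c.2
    rw [vecMul_truncation, segment_apply, coord_of_lt (by omega)]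
    simp only [matB, Matrix.row, Matrix.of_apply]
    split_ifs <;> first | rfl | omega

/-- Row ik + h + c of `A_i` is already this unit vector, and `blockDiag` fixes it because it changes
only the last block. -/
theorem single_mem_firstRowsSpace_matA_mul (hi : i + 1 ≤ s) (hik : 1 ≤ i) (hk : 0 < k)
    (X : Matrix (Fin (i * k + h)) (Fin (i * k + h)) F) {t : ℕ} {c : Fin (s * k + h)}
    (ht : t ≤ i * k + h + (s - i - 1) * k) (hc : (c : ℕ) < t - (i * k + h)) :
    Pi.single c 1 ∈ firstRowsSpace (matA F s k h i * blockDiag s k h i X) t := by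
  have hn := width_add (k := k) (h := h) hi
  have hki : k ≤ i * k := Nat.le_mul_of_pos_left k hik
  let r : Fin (s * k + h - 1) := ⟨i * k + h + c, by omega⟩
  have hr : (r : ℕ) = i * k + h + c := rfl
  have hrow : (matA F s k h i * blockDiag s k h i X).row r =
    Matrix.vecMul ((matA F s k h i).row r) (blockDiag s k h i X) := rfl
  have heq : (matA F s k h i * blockDiag s k h i X).row r = Pi.single c 1 := by
    rw [hrow]
    refine eq_of_coord_of_segment hi (fun c' hc' => ?_) ?_
    · rw [coord_vecMul_blockDiag X _ hc', coord_of_lt (by omega), coord_of_lt (by omega)]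
      simp only [matA, Matrix.row, Matrix.of_apply, Pi.single_apply, Fin.ext_iff, hr]
      split_ifs <;> first | rfl | omega
    · have h0 : segment (s * k + h) ((s - i - 1) * k + k) (i * k + h) ((matA F s k h i).row r) = 0 := by
        ext c'
        rw [segment_row_matA hi hik r c' (by omega), if_neg (by omega)]
        rfl
      rw [segment_vecMul_blockDiag hi, h0, Matrix.zero_vecMul]
      ext c'
      have := c'.2
      rw [segment_apply, coord_of_lt (by omega), Pi.single_eq_of_ne]
      · rfl
      · simp only [ne_eq, Fin.ext_iff]
        omega
  rw [← heq]
  exact row_mem_firstRowsSpace _ (by omega)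

theorem single_mem_firstRowsSpace_matB (hi : i + 1 ≤ s) (hik : 1 ≤ i) (hk : 0 < k) {t : ℕ}
    {c : Fin (s * k + h)} (ht : t ≤ i * k + h + (s - i - 1) * k) (hc : (c : ℕ) < t - (i * k + h)) :
    Pi.single c 1 ∈ firstRowsSpace (matB F s k h i) t := by
  have hn := width_add (k := k) (h := h) hi
  have hki : k ≤ i * k := Nat.le_mul_of_pos_left k hik
  let r : Fin (s * k + h - 1) := ⟨i * k + h + c, by omega⟩
  have hr : (r : ℕ) = i * k + h + c := rfl
  have heq : (matB F s k h i).row r = Pi.single c 1 := by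
    ext c'
    simp only [matB, Matrix.row, Matrix.of_apply, Pi.single_apply, Fin.ext_iff, hr]
    split_ifs <;> first | rfl | omega
  rw [← heq]
  exact row_mem_firstRowsSpace _ (by omega)

theorem coord_eq_zero_of_mem_matM {t c : ℕ} (hc : c + t < s * k + h) {v : Fin (s * k + h) → F}
    (hv : v ∈ firstRowsSpace (matM F s k h) t) : coord (s * k + h) c v = 0 := by
  have hle : firstRowsSpace (matM F s k h) t ≤ LinearMap.ker (coord (F := F) (s * k + h) c) := by
    rw [firstRowsSpace, Submodule.span_le]
    rintro _ ⟨r, hr, rfl⟩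
    simp only [Set.mem_ofPred_eq] at hr
    change coord _ c _ = 0
    rw [coord_of_lt (by omega)]
    simp only [matM, Matrix.row, Matrix.of_apply]
    exact if_neg (by omega)
  exact hle hv

/-- These common rows make `A_i` and `B_i` a pair at the smallest possible distance. -/
theorem row_matA_mul_one (hi : i + 1 ≤ s) {r : Fin (s * k + h - 1)} (hr : k ≤ (r : ℕ)) :
    (matA F s k h i * blockDiag s k h i 1).row r = (matB F s k h i).row r := by
  have hrow : (matA F s k h i * blockDiag s k h i 1).row r =
    Matrix.vecMul ((matA F s k h i).row r) (blockDiag s k h i 1) := rfl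
  have hAB : (matA F s k h i).row r = (matB F s k h i).row r := by
    ext c
    simp only [matA, matB, Matrix.row, Matrix.of_apply]
    rw [if_neg hr.not_gt, if_neg hr.not_gt]
  rw [hrow, ← hAB]
  refine eq_of_coord_of_segment hi (fun c hc => coord_vecMul_blockDiag _ _ hc) ?_
  rw [segment_vecMul_blockDiag hi, Matrix.vecMul_one]

end Generators

/-! ### Intersections of two spaces of the given shape. -/

section ShapeDimension

variable {F : Type*} [Field F] {n O k d t : ℕ}

theorem eq_zero_of_blocks (hn : O + k + d = n) {v : Fin n → F} (h1 : ∀ c < O, coord n c v = 0)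
    (h2 : ∀ r < k, coord n (O + r) v = 0) (h3 : segment n (O + k) d v = 0) : v = 0 := by
  refine eq_zero_of_coord fun c hc => ?_
  rcases lt_or_ge c O with hO | hO
  · exact h1 c hO
  rcases lt_or_ge c (O + k) with hk | hk
  · simpa only [Nat.add_sub_cancel' hO] using h2 (c - O) (by omega)
  · have := congrFun h3 ⟨c - (O + k), by omega⟩
    rw [segment_apply, Nat.add_sub_cancel' hk] at this
    exact this

theorem eq_zero_of_vecMul_eq_zero {Z : Matrix (Fin d) (Fin d) F} (hZ : IsUnit Z) {b : Fin d → F}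
    (hb : Matrix.vecMul b Z = 0) : b = 0 := by
  refine Matrix.vecMul_injective_of_isUnit hZ ?_
  change Matrix.vecMul b Z = Matrix.vecMul 0 Z
  rw [hb, Matrix.zero_vecMul]

theorem isUnit_det_of_isUnit {Z : Matrix (Fin d) (Fin d) F} (hZ : IsUnit Z) : IsUnit Z.det :=
  (Matrix.isUnit_iff_isUnit_det Z).mp hZ

/-- On vectors `b` supported outside of the first `k` entries, `b ↦ b * Z` has a left inverse. -/
theorem exists_retraction {Z : Matrix (Fin d) (Fin d) F} (hZ : IsUnit Z ∨ Z = truncation F k d) :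
    ∃ Q : Matrix (Fin d) (Fin d) F, ∀ b : Fin d → F, (∀ r : Fin d, (r : ℕ) < k → b r = 0) →
      Matrix.vecMul (Matrix.vecMul b Z) Q = b := by
  rcases hZ with hZ | rfl
  · refine ⟨Z⁻¹, fun b _ => ?_⟩
    rw [Matrix.vecMul_vecMul, Matrix.mul_nonsing_inv _ (isUnit_det_of_isUnit hZ), Matrix.vecMul_one]
  · refine ⟨1, fun b hb => ?_⟩
    ext r
    rw [Matrix.vecMul_one, vecMul_truncation]
    split_ifs with hr
    · exact (hb r hr).symm
    · rfl

/-- If the entries `0, …, t - d - 1` of `v ∈ S` and the entries from the `k`-th to the `(t-1)`-th of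
`w * Q`, where `w` consists of the last `d` entries of `v`, determine `v`, then `dim S ≤ t - k`. -/
theorem finrank_le_of_vecMul (hkd : k ≤ d) (Q : Matrix (Fin d) (Fin d) F) {S : Submodule F (Fin n → F)}
    (h : ∀ v ∈ S, (∀ c < t - d, coord n c v = 0) →
      (∀ r : Fin d, k ≤ r → (r : ℕ) < t → Matrix.vecMul (segment n (O + k) d v) Q r = 0) → v = 0) :
    Module.finrank F S ≤ t - k := by
  -- For t > d the count is (t - d) + (d - k). For t ≤ d the truncated t - d is 0, and the t - k
  -- entries of the product suffice.
  refine finrank_le_of_functionals S (fun j => if j < t - d then coord n j else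
    (coord d (k + (j - (t - d)))).comp ((Matrix.vecMulLinear Q).comp (segment n (O + k) d)))
    fun v hv hφ => h v hv (fun c hc => ?_) fun r hkr hrt => ?_
  · simpa only [if_pos hc] using hφ c (by omega)
  · have hr := r.2
    have := hφ (t - d + (r - k)) (by omega)
    rw [if_neg (by omega), show k + (t - d + (r - k) - (t - d)) = r by omega, LinearMap.comp_apply,
      coord_of_lt hr] at this
    exact this

/-- A zero middle block kills the first k entries of b. On such b the map b ↦ bZ is injective even
for diag(0, I), so the last block recovers b. -/
theorem finrank_le_of_middle_eq_zero (hn : O + k + d = n) (hkd : k ≤ d)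
    {Z : Matrix (Fin d) (Fin d) F} (hZ : IsUnit Z ∨ Z = truncation F k d)
    {S : Submodule F (Fin n → F)} (hS : S ≤ shapeSpace n O k d t Z)
    (h0 : ∀ v ∈ S, ∀ r < k, coord n (O + r) v = 0) : Module.finrank F S ≤ t - k := by
  obtain ⟨Q, hQ⟩ := exists_retraction hZ
  refine finrank_le_of_vecMul (O := O) hkd Q fun v hv h1 h2 => ?_
  obtain ⟨hvO, b, hbt, hvb, hvZ⟩ := hS hv
  have hbk : ∀ r : Fin d, (r : ℕ) < k → b r = 0 := fun r hr => by rw [← hvb r hr, h0 v hv r hr]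
  rw [hvZ, hQ b hbk] at h2
  have hb : b = 0 := by
    ext r
    rcases lt_or_ge (r : ℕ) k with hr | hr
    · exact hbk r hr
    rcases lt_or_ge (r : ℕ) t with hrt | hrt
    · exact h2 r hr hrt
    · exact hbt r hrt
  refine eq_zero_of_blocks hn (fun c hc => ?_) (h0 v hv) (by rw [hvZ, hb, Matrix.zero_vecMul])
  rcases lt_or_ge c (t - d) with hct | hct
  · exact h1 c hct
  · exact hvO c hct hc

/-- Two invertible matrices with invertible difference, or an invertible matrix and `diag (0, I)`. -/
def Separated (k : ℕ) (Z Z' : Matrix (Fin d) (Fin d) F) : Prop :=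
  (IsUnit Z ∧ IsUnit Z' ∧ IsUnit (Z - Z')) ∨ (IsUnit Z ∧ Z' = truncation F k d) ∨
    (Z = truncation F k d ∧ IsUnit Z')

/-- For two invertible matrices, Q = Z⁻¹ - Z'⁻¹ sends the common vector bZ = cZ' to b - c, and b = c
gives b(Z - Z') = 0. If one matrix is diag(0, I), the common vector itself has the required zeros,
and Q = 1. -/
theorem Separated.exists_matrix {Z Z' : Matrix (Fin d) (Fin d) F} (hZ : Separated k Z Z') :
    ∃ Q : Matrix (Fin d) (Fin d) F, ∀ b c : Fin d → F, (∀ r : Fin d, (r : ℕ) < k → b r = c r) →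
      Matrix.vecMul b Z = Matrix.vecMul c Z' →
      (∀ r : Fin d, (r : ℕ) < k → Matrix.vecMul (Matrix.vecMul b Z) Q r = 0) ∧
      (∀ r : Fin d, b r = 0 → c r = 0 → Matrix.vecMul (Matrix.vecMul b Z) Q r = 0) ∧
      (Matrix.vecMul (Matrix.vecMul b Z) Q = 0 → b = 0) := by
  rcases hZ with ⟨h1, h2, h3⟩ | ⟨h1, rfl⟩ | ⟨rfl, h1⟩
  · refine ⟨Z⁻¹ - Z'⁻¹, fun b c hbc hZ => ?_⟩
    have h : Matrix.vecMul (Matrix.vecMul b Z) (Z⁻¹ - Z'⁻¹) = b - c := by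
      rw [Matrix.vecMul_sub]
      nth_rewrite 2 [hZ]
      rw [Matrix.vecMul_vecMul, Matrix.vecMul_vecMul,
        Matrix.mul_nonsing_inv _ (isUnit_det_of_isUnit h1),
        Matrix.mul_nonsing_inv _ (isUnit_det_of_isUnit h2), Matrix.vecMul_one, Matrix.vecMul_one]
    rw [h]
    refine ⟨fun r hr => ?_, fun r hb hc => ?_, fun h0 => ?_⟩
    · rw [Pi.sub_apply, hbc r hr, sub_self]
    · rw [Pi.sub_apply, hb, hc, sub_self]
    · refine eq_zero_of_vecMul_eq_zero h3 ?_
      rw [Matrix.vecMul_sub, hZ, sub_eq_zero.mp h0, sub_self]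
  · refine ⟨1, fun b c hbc hZ => ?_⟩
    rw [Matrix.vecMul_one]
    refine ⟨fun r hr => ?_, fun r hb hc => ?_, fun h0 => eq_zero_of_vecMul_eq_zero h1 h0⟩
    · rw [hZ, vecMul_truncation, if_pos hr]
    · rw [hZ, vecMul_truncation, hc, ite_self]
  · refine ⟨1, fun b c hbc hZ => ?_⟩
    rw [Matrix.vecMul_one]
    refine ⟨fun r hr => ?_, fun r hb hc => ?_, fun h0 => ?_⟩
    · rw [vecMul_truncation, if_pos hr]
    · rw [vecMul_truncation, hb, ite_self]
    · have hc : c = 0 := eq_zero_of_vecMul_eq_zero h1 (hZ ▸ h0)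
      ext r
      rcases lt_or_ge (r : ℕ) k with hr | hr
      · rw [hbc r hr, hc]
      · have := congrFun h0 r
        rwa [vecMul_truncation, if_neg hr.not_gt] at this

/-- The case of equal i. Applied to the last block of a common vector, Q leaves only the entries
from k to t - 1; with the first t - d coordinates they determine the vector. -/
theorem finrank_inf_le_of_separated (hn : O + k + d = n) (hkd : k ≤ d)
    {Z Z' : Matrix (Fin d) (Fin d) F} (hZ : Separated k Z Z') {U V : Submodule F (Fin n → F)}
    (hU : U ≤ shapeSpace n O k d t Z) (hV : V ≤ shapeSpace n O k d t Z') :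
    Module.finrank F ↥(U ⊓ V) ≤ t - k := by
  obtain ⟨Q, hQ⟩ := hZ.exists_matrix
  refine finrank_le_of_vecMul (O := O) hkd Q fun v hv h1 h2 => ?_
  obtain ⟨hvO, b, hbt, hvb, hvZ⟩ := hU hv.1
  obtain ⟨-, c, hct, hvc, hvZ'⟩ := hV hv.2
  obtain ⟨g1, g2, g3⟩ := hQ b c (fun r hr => by rw [← hvb r hr, hvc r hr]) (hvZ.symm.trans hvZ')
  rw [hvZ] at h2
  have hb : b = 0 := by
    refine g3 ?_
    ext r
    rcases lt_or_ge (r : ℕ) k with hr | hr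
    · exact g1 r hr
    rcases lt_or_ge (r : ℕ) t with hrt | hrt
    · exact h2 r hr hrt
    · exact g2 r (hbt r hrt) (hct r hrt)
  refine eq_zero_of_blocks hn (fun c hc => ?_) (fun r hr => ?_) (by rw [hvZ, hb, Matrix.zero_vecMul])
  · rcases lt_or_ge c (t - d) with hct | hct
    · exact h1 c hct
    · exact hvO c hct hc
  · have := hvb ⟨r, by omega⟩ hr
    rwa [hb] at this

/-- The bound when the last columns vanish and `t = d + k`. -/
theorem finrank_le_of_right_eq_zero (hn : O + k + d = n) (hkd : k ≤ d) (ht : t = d + k)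
    (hO : 2 * k ≤ O) (hdO : d < 2 * k → 3 * k ≤ O)
    {Z : Matrix (Fin d) (Fin d) F} (hZ : IsUnit Z ∨ Z = truncation F k d)
    {S : Submodule F (Fin n → F)} (hS : S ≤ shapeSpace n O k d t Z)
    (h0 : ∀ v ∈ S, ∀ c, t + k ≤ c → coord n c v = 0) : Module.finrank F S ≤ t - k := by
  have htd : t - k = d := by omega
  rw [htd]
  rcases hZ with hZ | rfl
  -- Since 2k ≤ O, the last k columns lie at or beyond t + k and vanish. There remain k coordinates
  -- of the first block and d - k of the last.
  · refine finrank_le_of_functionals S (fun j => if j < k then coord n j else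
      coord n (O + k + (j - k))) fun v hv hφ => ?_
    obtain ⟨hvO, b, hbt, hvb, hvZ⟩ := hS hv
    have hseg : segment n (O + k) d v = 0 := by
      ext r
      have hr := r.2
      rw [segment_apply]
      rcases lt_or_ge (r : ℕ) (d - k) with hrd | hrd
      · have := hφ (k + r) (by omega)
        rwa [if_neg (by omega), Nat.add_sub_cancel_left] at this
      · exact h0 v hv _ (by omega)
    have hb : b = 0 := eq_zero_of_vecMul_eq_zero hZ (hvZ.symm.trans hseg)
    refine eq_zero_of_blocks hn (fun c hc => ?_) (fun r hr => ?_) hseg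
    · rcases lt_or_ge c k with hck | hck
      · simpa only [if_pos hck] using hφ c (by omega)
      · exact hvO c (by omega) hc
    · have := hvb ⟨r, by omega⟩ hr
      rwa [hb] at this
  -- Under diag(0, I) the first k entries of b are visible only in the middle block, the others only
  -- in the last block.
  · refine finrank_le_of_functionals S (fun j => if j < k then coord n j else if j - k < k then
      coord n (O + (j - k)) else coord n (O + k + (j - k))) fun v hv hφ => ?_
    obtain ⟨hvO, b, hbt, hvb, hvZ⟩ := hS hv
    have hbr : ∀ r : Fin d, k ≤ r → b r = coord n (O + k + r) v := by
      intro r hr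
      rw [← segment_apply (O + k) d v r, hvZ, vecMul_truncation, if_neg hr.not_gt]
    have hb : b = 0 := by
      ext r
      have hr := r.2
      rcases lt_or_ge (r : ℕ) (d - k) with hrd | hrd
      · have := hφ (k + r) (by omega)
        rw [if_neg (by omega), Nat.add_sub_cancel_left] at this
        split_ifs at this with hrk
        · rw [← hvb r hrk, this]
          rfl
        · rw [hbr r (by omega), this]
          rfl
      · rcases lt_or_ge (r : ℕ) k with hrk | hrk
        -- Here d - k ≤ r < k, so d < 2k and `hdO` gives 3k ≤ O; this puts column O + r at or beyond
        -- t + k.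
        · rw [← hvb r hrk]
          exact h0 v hv _ (by omega)
        · rw [hbr r hrk]
          exact h0 v hv _ (by omega)
    refine eq_zero_of_blocks hn (fun c hc => ?_) (fun r hr => ?_)
      (by rw [hvZ, hb, Matrix.zero_vecMul])
    · rcases lt_or_ge c k with hck | hck
      · simpa only [if_pos hck] using hφ c (by omega)
      · exact hvO c (by omega) hc
    · have := hvb ⟨r, by omega⟩ hr
      rwa [hb] at this

variable {O' d' : ℕ}

/-- Different indices `i < i'`, with `t ≤ d_i`. -/
theorem finrank_inf_le_of_le (hn' : O' + k + d' = n) (hkd' : k ≤ d')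
    (hO : O' + k ≤ O) (ht : t ≤ d) {Z : Matrix (Fin d) (Fin d) F} {Z' : Matrix (Fin d') (Fin d') F}
    (hZ' : IsUnit Z' ∨ Z' = truncation F k d') {U V : Submodule F (Fin n → F)}
    (hU : U ≤ shapeSpace n O k d t Z) (hV : V ≤ shapeSpace n O' k d' t Z') :
    Module.finrank F ↥(U ⊓ V) ≤ t - k :=
  -- As t - d = 0, `U` vanishes on all columns before O, and these include the middle block of `V`.
  finrank_le_of_middle_eq_zero hn' hkd' hZ' (inf_le_right.trans hV)
    fun _ hv r hr => (hU hv.1).1 (O' + r) (by omega) (by omega)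

/-- Different indices, when the unit vectors at `t - d', …, t - d' + k - 1` lie in `U`. -/
theorem finrank_inf_le_of_single_mem (hn' : O' + k + d' = n) (htd : t - d' + k ≤ t - d)
    (htO : t - d' ≤ O') (hkd' : k ≤ d') {Z' : Matrix (Fin d') (Fin d') F} {U V : Submodule F (Fin n → F)}
    (hU : ∀ c : Fin n, (c : ℕ) < t - d → Pi.single c 1 ∈ U)
    (hV : V ≤ shapeSpace n O' k d' t Z') (h : t - d' + k ≤ O' ∨ IsUnit Z') :
    Module.finrank F ↥(U ⊓ V) ≤ Module.finrank F U - k := by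
  refine finrank_inf_le_of_coord (a := t - d') (by omega) (fun c _ hc => hU c (by omega))
    fun v hv h0 => ?_
  obtain ⟨hvO, b, hbt, hvb, hvZ⟩ := hV hv
  rcases h with h | hZ'
  · refine eq_zero_of_coord fun c _ => ?_
    by_cases hc : c < t - d' ∨ t - d' + k ≤ c
    · exact h0 c hc
    · exact hvO c (by omega) (by omega)
  -- The window of unit vectors ends by column O' + k, because t - d' ≤ O'; so v is zero on the last
  -- block.
  · have hseg : segment n (O' + k) d' v = 0 := by
      ext r
      exact h0 _ (by omega)
    have hb : b = 0 := eq_zero_of_vecMul_eq_zero hZ' (hvZ.symm.trans hseg)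
    refine eq_zero_of_blocks hn' (fun c hc => ?_) (fun r hr => ?_) hseg
    · rcases lt_or_ge c (t - d') with hct | hct
      · exact h0 c (Or.inl hct)
      · exact hvO c hct hc
    · have := hvb ⟨r, by omega⟩ hr
      rwa [hb] at this

/-- Different indices, when the unit vectors at `O' + k, …, O' + 2 k - 1` lie in `U` and the second
space belongs to `diag (0, I)`. -/
theorem finrank_inf_le_of_single_mem_of_truncation (hn' : O' + k + d' = n) (htd : O' + k + k ≤ t - d)
    (hkd' : k ≤ d') {U V : Submodule F (Fin n → F)}
    (hU : ∀ c : Fin n, (c : ℕ) < t - d → Pi.single c 1 ∈ U)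
    (hV : V ≤ shapeSpace n O' k d' t (truncation F k d')) :
    Module.finrank F ↥(U ⊓ V) ≤ Module.finrank F U - k := by
  refine finrank_inf_le_of_coord (a := O' + k) (by omega) (fun c _ hc => hU c (by omega))
    fun v hv h0 => ?_
  obtain ⟨-, b, -, -, hvZ⟩ := hV hv
  refine eq_zero_of_coord fun c _ => ?_
  by_cases hc : c < O' + k ∨ O' + k + k ≤ c
  · exact h0 c hc
  · have := congrFun hvZ ⟨c - (O' + k), by omega⟩
    rw [vecMul_truncation, if_pos (by simp only; omega), segment_apply] at this
    simpa only [Nat.add_sub_cancel' (show O' + k ≤ c by omega)] using this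

/-- Different indices `i < i'`, with `t = d_j > d_i`. -/
theorem finrank_inf_le_of_gt {s h i i' j : ℕ} (hs4 : s ≠ 4) (hi : 1 ≤ i) (hii' : i < i')
    (hi' : i' + 1 ≤ s) (hij : i < j) (hj : j + 1 ≤ s)
    {Z : Matrix (Fin (i * k + h)) (Fin (i * k + h)) F}
    {Z' : Matrix (Fin (i' * k + h)) (Fin (i' * k + h)) F}
    (hZ : IsUnit Z ∨ Z = truncation F k _) (hZ' : IsUnit Z' ∨ Z' = truncation F k _)
    {U V : Submodule F (Fin (s * k + h) → F)} (hUt : Module.finrank F U = j * k + h)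
    (hUs : U ≤ shapeSpace _ ((s - i - 1) * k) k (i * k + h) (j * k + h) Z)
    (hU : ∀ c : Fin (s * k + h), (c : ℕ) < j * k + h - (i * k + h) → Pi.single c 1 ∈ U)
    (hV : V ≤ shapeSpace _ ((s - i' - 1) * k) k (i' * k + h) (j * k + h) Z') :
    Module.finrank F ↥(U ⊓ V) ≤ j * k + h - k := by
  have hn := width_add (k := k) (h := h) (show i + 1 ≤ s by omega)
  have hn' := width_add (k := k) (h := h) hi'
  have step : ∀ {a b : ℕ} (m : ℕ), a + m ≤ b → a * k + m * k ≤ b * k := fun m hab => by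
    rw [← Nat.add_mul]; exact Nat.mul_le_mul_right k hab
  have stepEq : ∀ {a b : ℕ} (m : ℕ), b = a + m → b * k = a * k + m * k := fun m hab => by
    rw [hab, Nat.add_mul]
  have hik := step (a := 0) 1 (show 0 + 1 ≤ i by omega)
  have hii'k := step 1 (show i + 1 ≤ i' by omega)
  have hijk := step 1 (show i + 1 ≤ j by omega)
  have hjk := step 1 hj
  have hi'k := step 1 hi'
  -- The window of k unit vectors starting at t - d' fails only if it reaches the middle block of
  -- `V` and `Z'` is not invertible.
  by_cases hcase : j * k + h - (i' * k + h) + k ≤ (s - i' - 1) * k ∨ IsUnit Z'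
  · rw [← hUt]
    exact finrank_inf_le_of_single_mem hn' (by omega) (by omega) (by omega) hU hV hcase
  obtain ⟨hp, hZ'u⟩ := not_or.mp hcase
  obtain rfl : Z' = truncation F k _ := hZ'.resolve_left hZ'u
  -- Next choice of window: the first k columns of the last block of `V`, where diag(0, I) forces
  -- zeros. `U` contains these unit vectors when i' and j both exceed i by at least 2.
  by_cases h2 : i + 2 ≤ i' ∧ i + 2 ≤ j
  · rw [← hUt]
    have h3 := step 2 h2.1
    have h4 := step 2 h2.2
    -- Both sides are multiples of k, and by `hp` the right one exceeds the left one by less than k.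
    have hpO : j * k + h - (i' * k + h) = (s - i' - 1) * k := by
      by_contra hne
      apply hp
      rcases lt_or_ge (i' + 1) s with h5 | h5
      · have := step 2 (show i' + 2 ≤ s by omega)
        rcases lt_or_ge (j + 1) s with h6 | h6
        · have := step 2 (show j + 2 ≤ s by omega)
          omega
        · have := stepEq 1 (show s = j + 1 by omega)
          omega
      · have := stepEq 1 (show s = i' + 1 by omega)
        have := step 0 (show j + 0 ≤ i' by omega)
        omega
    exact finrank_inf_le_of_single_mem_of_truncation hn' (by omega) (by omega) hU hV
  · have hjs : ¬ i' + 2 ≤ j ∨ ¬ j + 2 ≤ s := by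
      by_contra hne
      obtain ⟨h5, h6⟩ : i' + 2 ≤ j ∧ j + 2 ≤ s := by omega
      have := step 2 h5
      have := step 2 h6
      omega
    -- If i' = i + 1, the middle block of `U` occupies the first k columns of the last block of `V`,
    -- where diag(0, I) gives zeros.
    by_cases h3 : i' = i + 1
    · have h4 := stepEq 1 h3
      have h5 : (s - i - 1) * k = (s - i' - 1) * k + k := by omega
      refine finrank_le_of_middle_eq_zero hn (by omega) hZ (inf_le_left.trans hUs)
        fun v hv r hr => ?_
      obtain ⟨-, b, -, -, hvZ⟩ := hV hv.2
      have := congrFun hvZ ⟨r, by omega⟩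
      rw [vecMul_truncation, if_pos hr, segment_apply, ← h5] at this
      exact this
    -- Now j = i + 1 < i' = s - 1, so O' = 0. As b is supported on the first t entries, `V` vanishes
    -- from column t + k on.
    · have h4 : j = i + 1 := by omega
      have h5 := stepEq 1 h4
      have h6 := step 2 (show i + 2 ≤ i' by omega)
      have h7 : s = i' + 1 := by
        by_contra hne
        have := step 2 (show i' + 2 ≤ s by omega)
        omega
      have h8 := stepEq 1 h7
      refine finrank_le_of_right_eq_zero hn (by omega) (by omega) (by omega) (fun hd => ?_) hZ
        (inf_le_left.trans hUs) fun v hv c hc => ?_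
      -- The only use of s ≠ 4: d < 2k forces i = 1, so i' ≥ 3, and s = i' + 1 ≠ 4 improves this to
      -- i' ≥ 4, whence O ≥ 3k.
      · have h9 : i = 1 := by
          by_contra hne
          have := step (a := 0) 2 (show 0 + 2 ≤ i by omega)
          omega
        have := stepEq (a := 0) 1 (show i = 0 + 1 by omega)
        have := step (a := 0) 4 (show 0 + 4 ≤ i' by omega)
        omega
      · obtain ⟨-, b, hbt, -, hvZ⟩ := hV hv.2
        rcases lt_or_ge c (s * k + h) with hcn | hcn
        · have := congrFun hvZ ⟨c - k, by omega⟩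
          rw [vecMul_truncation, hbt _ (by simp only; omega), ite_self, segment_apply,
            show (s - i' - 1) * k + k + (c - k) = c by omega] at this
          exact this
        · exact coord_of_le hcn v

end ShapeDimension

/-! ### Subspace distance in terms of intersections. -/

section Distance

variable {F : Type*} [Field F] {n t : ℕ}

theorem finrank_sup_add_finrank_inf {U V : Submodule F (Fin n → F)}
    (hU : Module.finrank F U = t) (hV : Module.finrank F V = t) :
    Module.finrank F ↥(U ⊔ V) + Module.finrank F ↥(U ⊓ V) = 2 * t := by
  rw [Submodule.finrank_sup_add_finrank_inf_eq, hU, hV, two_mul]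

theorem finrank_le_dim (U : Submodule F (Fin n → F)) : Module.finrank F U ≤ n := by
  simpa using U.finrank_le

theorem le_subspaceDist_of_finrank_inf_le {U V : Submodule F (Fin n → F)} {a : ℕ}
    (hU : Module.finrank F U = t) (hV : Module.finrank F V = t)
    (h : Module.finrank F ↥(U ⊓ V) ≤ a) : 2 * t - 2 * a ≤ subspaceDist U V := by
  have := finrank_sup_add_finrank_inf hU hV
  rw [subspaceDist]
  omega

theorem subspaceDist_le_of_le_finrank_inf {U V : Submodule F (Fin n → F)} {a : ℕ}
    (hU : Module.finrank F U = t) (hV : Module.finrank F V = t)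
    (h : a ≤ Module.finrank F ↥(U ⊓ V)) : subspaceDist U V ≤ 2 * t - 2 * a := by
  have := finrank_sup_add_finrank_inf hU hV
  rw [subspaceDist]
  omega

/-- The minimum distance contributed by a component of dimension `t`. -/
def componentDist (n k t : ℕ) : ℕ :=
  if t ≤ k then 2 * t else if n - k ≤ t then 2 * (n - t) else 2 * k

theorem componentDist_pos {k : ℕ} (hk : 0 < k) (ht : 0 < t) (htn : t < n) :
    0 < componentDist n k t := by
  rw [componentDist]
  split_ifs <;> omega

theorem sum_componentDist {r : ℕ} (n k : ℕ) (t : Fin r → ℕ) :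
    ∑ i, componentDist n k (t i) =
      (∑ i with t i ≤ k, 2 * t i) + (∑ i with k < t i ∧ n - k ≤ t i, 2 * (n - t i)) +
        (∑ i with k < t i ∧ t i < n - k, 2 * k) := by
  rw [Finset.sum_filter, Finset.sum_filter, Finset.sum_filter, ← Finset.sum_add_distrib,
    ← Finset.sum_add_distrib]
  refine Finset.sum_congr rfl fun i _ => ?_
  rw [componentDist]
  split_ifs <;> omega

theorem ne_of_subspaceDist_pos {U V : Submodule F (Fin n → F)} (h : 0 < subspaceDist U V) :
    U ≠ V := by
  rintro rfl
  rw [subspaceDist, sup_idem, inf_idem, Nat.sub_self] at h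
  exact h.false

end Distance

/-! ### Indexing the generators and the estimate for all pairs. -/

section GenIndex

variable {F : Type*} [Field F] (s k h : ℕ) (f : ℕ → F[X])

/-- An index set for the generator matrices: `none` stands for `M`, the pair `(i, none)` for
`B_{i+1}` and `(i, X)` for `A_{i+1} diag (I, I, X)`. -/
abbrev GenIndex : Type _ :=
  Option (Σ i : Fin (s - 1),
    Option (Submonoid.powers (companion (f ((i : ℕ) + 1)) (((i : ℕ) + 1) * k + h))))

variable {s k h f}

/-- The matrix that determines the last columns of the first rows of a generator matrix. -/
def lastBlock {i : ℕ} : Option (Submonoid.powers (companion (f i) (i * k + h))) →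
    Matrix (Fin (i * k + h)) (Fin (i * k + h)) F
  | none => truncation F k _
  | some X => X

variable (s) in
/-- The generator matrices `B_i` and `A_i diag (I, I, X)`. -/
def blockMatrix {i : ℕ} : Option (Submonoid.powers (companion (f i) (i * k + h))) →
    Matrix (Fin (s * k + h - 1)) (Fin (s * k + h)) F
  | none => matB F s k h i
  | some X => matA F s k h i * blockDiag s k h i X

/-- The generator matrix with a given index. -/
def genMatrix : GenIndex s k h f → Matrix (Fin (s * k + h - 1)) (Fin (s * k + h)) F
  | none => matM F s k h
  | some ⟨_, o⟩ => blockMatrix s o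

theorem range_genMatrix : Set.range (genMatrix (s := s) (k := k) (h := h) (f := f)) =
    generators s k h f := by
  ext W
  constructor
  · rintro ⟨_ | ⟨i, _ | X⟩, rfl⟩
    · exact Or.inr rfl
    · exact Or.inl ⟨i + 1, by omega, by omega, Or.inr rfl⟩
    · exact Or.inl ⟨i + 1, by omega, by omega, Or.inl ⟨_, ⟨X, X.2, rfl⟩, rfl⟩⟩
  · rintro (⟨i, h1, h2, hW⟩ | rfl)
    · obtain ⟨j, rfl⟩ := Nat.exists_eq_add_of_le' h1
      rcases hW with ⟨_, ⟨X, hX, rfl⟩, rfl⟩ | rfl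
      · exact ⟨some ⟨⟨j, by omega⟩, some ⟨X, hX⟩⟩, rfl⟩
      · exact ⟨some ⟨⟨j, by omega⟩, none⟩, rfl⟩
    · exact ⟨none, rfl⟩

theorem flagCode_eq_range {r : ℕ} (t : Fin r → ℕ) :
    flagCode s k h f t = Set.range fun p : GenIndex s k h f => flagOf t (genMatrix p) := by
  rw [flagCode, ← range_genMatrix, ← Set.range_comp]
  rfl

section Block

variable {i : ℕ} (o : Option (Submonoid.powers (companion (f i) (i * k + h))))

theorem firstRowsSpace_blockMatrix_le (hi : i + 1 ≤ s) (hik : 1 ≤ i) {t : ℕ}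
    (ht : t ≤ i * k + h + (s - i - 1) * k) :
    firstRowsSpace (blockMatrix s o) t ≤
      shapeSpace (s * k + h) ((s - i - 1) * k) k (i * k + h) t (lastBlock o) := by
  cases o with
  | none => exact firstRowsSpace_matB_le hi hik ht
  | some X => exact firstRowsSpace_matA_mul_le hi hik _ ht

theorem single_mem_firstRowsSpace_blockMatrix (hi : i + 1 ≤ s) (hik : 1 ≤ i) (hk : 0 < k) {t : ℕ}
    {c : Fin (s * k + h)} (ht : t ≤ i * k + h + (s - i - 1) * k) (hc : (c : ℕ) < t - (i * k + h)) :
    Pi.single c 1 ∈ firstRowsSpace (blockMatrix s o) t := by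
  cases o with
  | none => exact single_mem_firstRowsSpace_matB hi hik hk ht hc
  | some X => exact single_mem_firstRowsSpace_matA_mul hi hik hk _ ht hc

variable [Fintype F]

theorem isUnit_lastBlock_or (hf : IsPrimitivePoly (f i) (i * k + h)) (hik : 1 ≤ i) (hk : 0 < k) :
    IsUnit (lastBlock o) ∨ lastBlock o = truncation F k (i * k + h) := by
  cases o with
  | none => exact Or.inr rfl
  | some X => exact Or.inl (hf.isUnit_of_mem_powers (Nat.add_pos_left (Nat.mul_pos hik hk) h) X.2)

theorem linearIndependent_row_blockMatrix (hf : IsPrimitivePoly (f i) (i * k + h))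
    (hi : i + 1 ≤ s) (hik : 1 ≤ i) (hk : 0 < k) :
    LinearIndependent F (blockMatrix s o).row := by
  cases o with
  | none => exact linearIndependent_row_matB hi hk hik
  | some X =>
    exact linearIndependent_row_matA_mul hi hk hik
      (hf.isUnit_of_mem_powers (Nat.add_pos_left (Nat.mul_pos hik hk) h) X.2)

theorem separated_lastBlock (hf : IsPrimitivePoly (f i) (i * k + h)) (hik : 1 ≤ i) (hk : 0 < k)
    {o o' : Option (Submonoid.powers (companion (f i) (i * k + h)))} (ho : o ≠ o') :
    Separated k (lastBlock o) (lastBlock o') := by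
  have hd : 0 < i * k + h := Nat.add_pos_left (Nat.mul_pos hik hk) h
  rcases o with _ | X <;> rcases o' with _ | Y
  · exact absurd rfl ho
  · exact Or.inr (Or.inr ⟨rfl, hf.isUnit_of_mem_powers hd Y.2⟩)
  · exact Or.inr (Or.inl ⟨hf.isUnit_of_mem_powers hd X.2, rfl⟩)
  · refine Or.inl ⟨hf.isUnit_of_mem_powers hd X.2, hf.isUnit_of_mem_powers hd Y.2,
      hf.isUnit_sub_of_mem_powers X.2 Y.2 fun hXY => ho ?_⟩
    rw [Subtype.ext hXY]

end Block

variable [Fintype F]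

theorem linearIndependent_row_genMatrix (hk : 0 < k)
    (hf : ∀ i, 1 ≤ i → i ≤ s - 1 → IsPrimitivePoly (f i) (i * k + h)) (p : GenIndex s k h f) :
    LinearIndependent F (genMatrix p).row := by
  rcases p with _ | ⟨i, o⟩
  · exact linearIndependent_row_matM
  · exact linearIndependent_row_blockMatrix o (hf _ (by omega) (by omega)) (by omega) (by omega) hk

/-- The dimensions up to `k + h`, and those of the form `j k + h`. -/
def IsBlockDim (s k h t : ℕ) : Prop := t ≤ k + h ∨ ∃ j, 2 ≤ j ∧ j + 1 ≤ s ∧ t = j * k + h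

/-- The right-hand side is n - k, so the last k - 1 rows never enter the shape analysis. -/
theorem IsBlockDim.le {t i : ℕ} (ht : IsBlockDim s k h t) (hs : 2 ≤ s) (hi : i + 1 ≤ s) :
    t ≤ i * k + h + (s - i - 1) * k := by
  have hn := width_add (k := k) (h := h) hi
  rcases ht with ht | ⟨j, -, h2, rfl⟩
  · have := Nat.mul_le_mul_right k hs
    omega
  · have := Nat.mul_le_mul_right k h2
    rw [Nat.add_mul] at this
    omega

theorem IsBlockDim.lt_of_gt {t i : ℕ} (ht : IsBlockDim s k h t) (hi : 1 ≤ i) (hit : i * k + h < t) :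
    ∃ j, i < j ∧ j + 1 ≤ s ∧ t = j * k + h := by
  rcases ht with ht | ⟨j, -, h2, rfl⟩
  · have := Nat.le_mul_of_pos_left k hi
    omega
  · refine ⟨j, ?_, h2, rfl⟩
    by_contra hij
    have := Nat.mul_le_mul_right k (not_lt.mp hij)
    omega

/-- The space of `M` lives on the last t columns. For t ≤ ik + h these miss the middle block; for
larger t the other space contains the first k unit vectors, on whose columns `M` contributes zeros
since t ≤ n - k. -/
theorem finrank_inf_matM_le (hs : 2 ≤ s) (hk : 0 < k) {i t : ℕ} (hik : 1 ≤ i) (hi : i + 1 ≤ s)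
    (hf : IsPrimitivePoly (f i) (i * k + h)) (ht : IsBlockDim s k h t)
    (o : Option (Submonoid.powers (companion (f i) (i * k + h)))) :
    Module.finrank F ↥(firstRowsSpace (blockMatrix s o) t ⊓ firstRowsSpace (matM F s k h) t) ≤
      t - k := by
  have hn := width_add (k := k) (h := h) hi
  have hki := Nat.le_mul_of_pos_left k hik
  have htn := ht.le hs hi
  rcases le_or_gt t (i * k + h) with hti | hti
  · exact finrank_le_of_middle_eq_zero hn (by omega) (isUnit_lastBlock_or o hf hik hk)
      (inf_le_left.trans (firstRowsSpace_blockMatrix_le o hi hik htn))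
      fun v hv r hr => coord_eq_zero_of_mem_matM (by omega) hv.2
  · obtain ⟨j, hij, -, htj⟩ := ht.lt_of_gt hik hti
    have := Nat.mul_le_mul_right k (show i + 1 ≤ j by omega)
    rw [Nat.add_mul] at this
    have hU := finrank_firstRowsSpace (linearIndependent_row_blockMatrix o hf hi hik hk)
      (show t ≤ s * k + h - 1 by omega)
    have hle := finrank_inf_le_of_coord (U := firstRowsSpace (blockMatrix s o) t)
      (V := firstRowsSpace (matM F s k h) t) (a := 0) (k := k) (by omega)
      (fun c _ hc => single_mem_firstRowsSpace_blockMatrix o hi hik hk htn (by omega))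
      fun v hv h0 => eq_zero_of_coord fun c _ => ?_
    · rwa [hU] at hle
    · by_cases hc : c < 0 ∨ 0 + k ≤ c
      · exact h0 c hc
      · exact coord_eq_zero_of_mem_matM (by omega) hv

theorem finrank_inf_blockMatrix_le (hs : 2 ≤ s) (hs4 : s ≠ 4) (hk : 0 < k) {i i' t : ℕ}
    (hik : 1 ≤ i) (hii' : i < i') (hi' : i' + 1 ≤ s)
    (hf : IsPrimitivePoly (f i) (i * k + h)) (hf' : IsPrimitivePoly (f i') (i' * k + h))
    (ht : IsBlockDim s k h t)
    (o : Option (Submonoid.powers (companion (f i) (i * k + h))))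
    (o' : Option (Submonoid.powers (companion (f i') (i' * k + h)))) :
    Module.finrank F ↥(firstRowsSpace (blockMatrix s o) t ⊓ firstRowsSpace (blockMatrix s o') t) ≤
      t - k := by
  have hi : i + 1 ≤ s := by omega
  have hn := width_add (k := k) (h := h) hi
  have hn' := width_add (k := k) (h := h) hi'
  have hki := Nat.le_mul_of_pos_left k hik
  have hii := Nat.mul_le_mul_right k (Nat.succ_le_of_lt hii')
  rw [Nat.succ_eq_add_one, Nat.add_mul] at hii
  have htn := ht.le hs hi
  have htn' := ht.le hs hi'
  have hU := firstRowsSpace_blockMatrix_le o hi hik htn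
  have hV := firstRowsSpace_blockMatrix_le o' hi' (by omega) htn'
  have hZ' := isUnit_lastBlock_or o' hf' (by omega) hk
  rcases le_or_gt t (i * k + h) with hti | hti
  · exact finrank_inf_le_of_le hn' (by omega) (by omega) hti hZ' hU hV
  · obtain ⟨j, hij, hj, rfl⟩ := ht.lt_of_gt hik hti
    exact finrank_inf_le_of_gt hs4 hik hii' hi' hij hj (isUnit_lastBlock_or o hf hik hk) hZ'
      (finrank_firstRowsSpace (linearIndependent_row_blockMatrix o hf hi hik hk) (by omega)) hU
      (fun c hc => single_mem_firstRowsSpace_blockMatrix o hi hik hk htn hc) hV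

theorem finrank_inf_genMatrix_le (hs : 2 ≤ s) (hs4 : s ≠ 4) (hk : 0 < k)
    (hf : ∀ i, 1 ≤ i → i ≤ s - 1 → IsPrimitivePoly (f i) (i * k + h)) {t : ℕ}
    (ht : IsBlockDim s k h t) {p p' : GenIndex s k h f} (hp : p ≠ p') :
    Module.finrank F ↥(firstRowsSpace (genMatrix p) t ⊓ firstRowsSpace (genMatrix p') t) ≤
      t - k := by
  rcases p with _ | ⟨i, o⟩ <;> rcases p' with _ | ⟨i', o'⟩
  · exact absurd rfl hp
  · rw [inf_comm]
    exact finrank_inf_matM_le hs hk (by omega) (by omega) (hf _ (by omega) (by omega)) ht o'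
  · exact finrank_inf_matM_le hs hk (by omega) (by omega) (hf _ (by omega) (by omega)) ht o
  · rcases lt_trichotomy i i' with hii | rfl | hii
    · exact finrank_inf_blockMatrix_le hs hs4 hk (by omega) (by omega) (by omega)
        (hf _ (by omega) (by omega)) (hf _ (by omega) (by omega)) ht o o'
    · have ho : o ≠ o' := fun ho => hp (by rw [ho])
      have hi : (i : ℕ) + 1 + 1 ≤ s := by omega
      have hki := Nat.le_mul_of_pos_left k (Nat.succ_pos i)
      exact finrank_inf_le_of_separated (width_add hi) (hki.trans (Nat.le_add_right _ _))
        (separated_lastBlock (hf _ (by omega) (by omega)) (by omega) hk ho)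
        (firstRowsSpace_blockMatrix_le o hi (by omega) (ht.le hs hi))
        (firstRowsSpace_blockMatrix_le o' hi (by omega) (ht.le hs hi))
    · rw [inf_comm]
      exact finrank_inf_blockMatrix_le hs hs4 hk (by omega) (by omega) (by omega)
        (hf _ (by omega) (by omega)) (hf _ (by omega) (by omega)) ht o' o

/-! ### Distances in every admissible dimension. -/

theorem bounds_of_mem_longType (hs : 2 ≤ s) (hk : 0 < k) {t : ℕ} (ht : t ∈ longType s k h) :
    0 < t ∧ t < s * k + h := by
  have h2 := Nat.mul_le_mul_right k hs
  rcases ht with ⟨h1, h2⟩ | ⟨j, h1, h2, rfl⟩ | ⟨h1, h2⟩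
  · omega
  · have := Nat.mul_le_mul_right k h1
    have := Nat.mul_le_mul_right k (show j + 1 ≤ s by omega)
    rw [Nat.add_mul] at this
    omega
  · omega

theorem componentDist_le_subspaceDist (hs : 2 ≤ s) (hs4 : s ≠ 4) (hk : 0 < k)
    (hf : ∀ i, 1 ≤ i → i ≤ s - 1 → IsPrimitivePoly (f i) (i * k + h)) {t : ℕ}
    (ht : t ∈ longType s k h) {p p' : GenIndex s k h f} (hp : p ≠ p') :
    componentDist (s * k + h) k t ≤
      subspaceDist (firstRowsSpace (genMatrix p) t) (firstRowsSpace (genMatrix p') t) := by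
  obtain ⟨ht0, htn⟩ := bounds_of_mem_longType hs hk ht
  have h2 := Nat.mul_le_mul_right k hs
  have hdim : ∀ (q : GenIndex s k h f) (u : ℕ), u < s * k + h →
      Module.finrank F (firstRowsSpace (genMatrix q) u) = u := fun q u hu =>
    finrank_firstRowsSpace (linearIndependent_row_genMatrix hk hf q) (by omega)
  rw [componentDist]
  split_ifs with h3 h4
  · have := finrank_inf_genMatrix_le hs hs4 hk hf (Or.inl (by omega) : IsBlockDim s k h t) hp
    have := le_subspaceDist_of_finrank_inf_le (hdim p t htn) (hdim p' t htn) this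
    omega
  -- For t ≥ n - k the estimate is applied in dimension n - k = (s - 1)k + h. There the sum of the
  -- two spaces is already everything, and by monotonicity it stays so in dimension t.
  · have hb : IsBlockDim s k h (s * k + h - k) := by
      rcases Nat.eq_or_lt_of_le hs with rfl | hs3
      · exact Or.inl (by omega)
      · refine Or.inr ⟨s - 1, by omega, by omega, ?_⟩
        have : s * k = (s - 1) * k + 1 * k := by
          rw [← Nat.add_mul, Nat.sub_add_cancel (by omega)]
        omega
    have h5 := finrank_inf_genMatrix_le hs hs4 hk hf hb hp
    have h6 := finrank_sup_add_finrank_inf (hdim p (s * k + h - k) (by omega))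
      (hdim p' (s * k + h - k) (by omega))
    have h7 := Submodule.finrank_mono (sup_le_sup (firstRowsSpace_mono (genMatrix p) h4)
      (firstRowsSpace_mono (genMatrix p') h4))
    have h8 := finrank_sup_add_finrank_inf (hdim p t htn) (hdim p' t htn)
    rw [subspaceDist]
    omega
  · have hb : IsBlockDim s k h t := by
      rcases ht with ht | ⟨j, h5, h6, rfl⟩ | ht
      · exact Or.inl ht.2
      · exact Or.inr ⟨j, h5, by omega, rfl⟩
      · exact absurd ht.1 h4
    have := finrank_inf_genMatrix_le hs hs4 hk hf hb hp
    have := le_subspaceDist_of_finrank_inf_le (hdim p t htn) (hdim p' t htn) this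
    omega

theorem injective_firstRowsSpace_genMatrix (hs : 2 ≤ s) (hs4 : s ≠ 4) (hk : 0 < k)
    (hf : ∀ i, 1 ≤ i → i ≤ s - 1 → IsPrimitivePoly (f i) (i * k + h)) {t : ℕ}
    (ht : t ∈ longType s k h) :
    Function.Injective fun p : GenIndex s k h f => firstRowsSpace (genMatrix p) t := by
  intro p p' hpp'
  by_contra hp
  obtain ⟨ht0, htn⟩ := bounds_of_mem_longType hs hk ht
  exact ne_of_subspaceDist_pos ((componentDist_pos hk ht0 htn).trans_le
    (componentDist_le_subspaceDist hs hs4 hk hf ht hp)) hpp'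

/-- The pair `A_{s-1}`, `B_{s-1}` attains the minimum in every component. -/
theorem exists_subspaceDist_le_componentDist (hs : 2 ≤ s) (hk : 0 < k)
    (hf : ∀ i, 1 ≤ i → i ≤ s - 1 → IsPrimitivePoly (f i) (i * k + h)) :
    ∃ p p' : GenIndex s k h f, p ≠ p' ∧ ∀ t < s * k + h,
      subspaceDist (firstRowsSpace (genMatrix p) t) (firstRowsSpace (genMatrix p') t) ≤
        componentDist (s * k + h) k t := by
  refine ⟨some ⟨⟨s - 2, by omega⟩, some 1⟩, some ⟨⟨s - 2, by omega⟩, none⟩, by simp,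
    fun t htn => ?_⟩
  generalize hP : (some ⟨⟨s - 2, by omega⟩, some 1⟩ : GenIndex s k h f) = p
  generalize hP' : (some ⟨⟨s - 2, by omega⟩, none⟩ : GenIndex s k h f) = p'
  have hp := finrank_firstRowsSpace (linearIndependent_row_genMatrix hk hf p)
    (show t ≤ s * k + h - 1 by omega)
  have hp' := finrank_firstRowsSpace (linearIndependent_row_genMatrix hk hf p')
    (show t ≤ s * k + h - 1 by omega)
  have h1 := subspaceDist_le_of_le_finrank_inf hp hp'
    (le_finrank_inf_of_row_eq (a := k) (linearIndependent_row_genMatrix hk hf p) (by omega)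
      fun r hr _ => by
        rw [← hP, ← hP']
        exact row_matA_mul_one (by omega) hr)
  have h2 := finrank_sup_add_finrank_inf hp hp'
  have h3 := finrank_le_dim (firstRowsSpace (genMatrix p) t ⊔ firstRowsSpace (genMatrix p') t)
  rw [componentDist]
  split_ifs
  · omega
  · rw [subspaceDist]
    omega
  · omega

/-! ### Cardinalities and the final assembly. -/

theorem card_genIndex (hk : 0 < k)
    (hf : ∀ i, 1 ≤ i → i ≤ s - 1 → IsPrimitivePoly (f i) (i * k + h)) :
    Nat.card (GenIndex s k h f) =
      (∑ i ∈ Finset.Icc 1 (s - 1), Fintype.card F ^ (i * k + h)) + 1 := by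
  have hfin : ∀ d : ℕ, Finite (Matrix (Fin d) (Fin d) F) := fun d =>
    inferInstanceAs (Finite (Fin d → Fin d → F))
  rw [Finite.card_option, Nat.card_sigma]
  congr 1
  have hterm : ∀ i : Fin (s - 1), Nat.card
      (Option (Submonoid.powers (companion (f ((i : ℕ) + 1)) (((i : ℕ) + 1) * k + h)))) =
      Fintype.card F ^ (((i : ℕ) + 1) * k + h) := by
    intro i
    rw [Finite.card_option, (hf _ (by omega) (by omega)).card_powers_companion
      (Nat.add_pos_left (Nat.mul_pos (Nat.succ_pos _) hk) h)]
    exact Nat.sub_add_cancel (Nat.one_le_pow _ _ Fintype.card_pos)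
  rw [Finset.sum_congr rfl fun i _ => hterm i,
    Fin.sum_univ_eq_sum_range (fun i => Fintype.card F ^ ((i + 1) * k + h)),
    Finset.range_eq_Ico, Finset.sum_Ico_add' (fun i => Fintype.card F ^ (i * k + h))]
  rfl

theorem ncard_range_eq_card {α β : Type*} {g : α → β} (hg : Function.Injective g) :
    (Set.range g).ncard = Nat.card α :=
  Nat.card_range_of_injective hg

theorem ncard_flagCode (hs : 2 ≤ s) (hs4 : s ≠ 4) (hk : 0 < k)
    (hf : ∀ i, 1 ≤ i → i ≤ s - 1 → IsPrimitivePoly (f i) (i * k + h)) {r : ℕ} {t : Fin r → ℕ}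
    {i : Fin r} (ht : t i ∈ longType s k h) :
    (flagCode s k h f t).ncard = Nat.card (GenIndex s k h f) := by
  rw [flagCode_eq_range]
  exact ncard_range_eq_card fun p p' hpp' =>
    injective_firstRowsSpace_genMatrix hs hs4 hk hf ht (congrFun hpp' i)

theorem ncard_projectedCode (hs : 2 ≤ s) (hs4 : s ≠ 4) (hk : 0 < k)
    (hf : ∀ i, 1 ≤ i → i ≤ s - 1 → IsPrimitivePoly (f i) (i * k + h)) {r : ℕ} {t : Fin r → ℕ}
    {i : Fin r} (ht : t i ∈ longType s k h) :
    (projectedCode (flagCode s k h f t) i).ncard = Nat.card (GenIndex s k h f) := by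
  rw [flagCode_eq_range, projectedCode, ← Set.range_comp]
  exact ncard_range_eq_card (injective_firstRowsSpace_genMatrix hs hs4 hk hf ht)

theorem ncard_subspaceCode (hs : 2 ≤ s) (hs4 : s ≠ 4) (hk : 0 < k)
    (hf : ∀ i, 1 ≤ i → i ≤ s - 1 → IsPrimitivePoly (f i) (i * k + h)) :
    (subspaceCode s k h f).ncard = Nat.card (GenIndex s k h f) := by
  have h2 := Nat.mul_le_mul_right k hs
  rw [subspaceCode, ← range_genMatrix, ← Set.range_comp]
  have h1 : rowSpace ∘ (genMatrix : GenIndex s k h f → _) =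
      fun p => firstRowsSpace (genMatrix p) (s * k + h - 1) :=
    funext fun p => rowSpace_eq_firstRowsSpace _
  rw [h1]
  exact ncard_range_eq_card (injective_firstRowsSpace_genMatrix hs hs4 hk hf
    (Or.inr (Or.inr ⟨by omega, le_rfl⟩)))

theorem isFlagCode_flagCode (hs : 2 ≤ s) (hk : 0 < k)
    (hf : ∀ i, 1 ≤ i → i ≤ s - 1 → IsPrimitivePoly (f i) (i * k + h)) {r : ℕ} {t : Fin r → ℕ}
    (ht : StrictMono t) (htmem : ∀ i, t i ∈ longType s k h) :
    IsFlagCode t (flagCode s k h f t) := by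
  rw [flagCode_eq_range]
  refine ⟨⟨_, none, rfl⟩, ?_⟩
  rintro _ ⟨p, rfl⟩
  have hb := fun i => bounds_of_mem_longType hs hk (htmem i)
  have hdim : ∀ i, Module.finrank F (firstRowsSpace (genMatrix p) (t i)) = t i := fun i =>
    finrank_firstRowsSpace (linearIndependent_row_genMatrix hk hf p) (by have := hb i; omega)
  refine ⟨fun i => ?_, fun i j hij => ?_, fun i => ?_, hdim⟩
  · rw [bot_lt_iff_ne_bot]
    intro h0
    have h1 := hdim i
    change firstRowsSpace (genMatrix p) (t i) = ⊥ at h0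
    rw [h0, finrank_bot] at h1
    exact (hb i).1.ne h1
  · refine lt_of_le_of_ne (firstRowsSpace_mono _ (ht hij).le) fun h0 => (ht hij).ne ?_
    rw [← hdim i, ← hdim j]
    exact congrArg (fun U : Submodule F (Fin (s * k + h) → F) => Module.finrank F U) h0
  · rw [lt_top_iff_ne_top]
    intro h0
    have h1 := hdim i
    change firstRowsSpace (genMatrix p) (t i) = ⊤ at h0
    rw [h0, finrank_top, Module.finrank_fin_fun] at h1
    exact (hb i).2.ne' h1

/-- One pair is minimal in all components simultaneously, so the minimum of the sum is the sum of
the componentwise minima. -/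
theorem hasMinDist_flagCode (hs : 2 ≤ s) (hs4 : s ≠ 4) (hk : 0 < k)
    (hf : ∀ i, 1 ≤ i → i ≤ s - 1 → IsPrimitivePoly (f i) (i * k + h)) {r : ℕ} (hr : 0 < r)
    {t : Fin r → ℕ} (htmem : ∀ i, t i ∈ longType s k h) :
    HasMinDist (flagCode s k h f t) (∑ i, componentDist (s * k + h) k (t i)) := by
  have hlow : ∀ p p' : GenIndex s k h f, p ≠ p' → ∀ i, componentDist (s * k + h) k (t i) ≤
      subspaceDist (flagOf t (genMatrix p) i) (flagOf t (genMatrix p') i) := fun p p' hp i =>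
    componentDist_le_subspaceDist hs hs4 hk hf (htmem i) hp
  rw [flagCode_eq_range]
  constructor
  · obtain ⟨p, p', hp, hle⟩ := exists_subspaceDist_le_componentDist hs hk hf
    refine ⟨_, ⟨p, rfl⟩, _, ⟨p', rfl⟩, fun h0 => hp ?_, ?_⟩
    · exact injective_firstRowsSpace_genMatrix hs hs4 hk hf (htmem ⟨0, hr⟩) (congrFun h0 ⟨0, hr⟩)
    · exact Finset.sum_congr rfl fun i _ =>
        (hlow p p' hp i).antisymm (hle _ (bounds_of_mem_longType hs hk (htmem i)).2)
  · rintro _ ⟨_, ⟨p, rfl⟩, _, ⟨p', rfl⟩, hne, rfl⟩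
    exact Finset.sum_le_sum fun i _ => hlow p p' (fun hp => hne (by rw [hp])) i

end GenIndex

end FlagCode

theorem theorem4p5 {F : Type*} [Field F] [Fintype F] (s k h : ℕ)
    (hs : 2 ≤ s) (hs4 : s ≠ 4) (hhk : h < k)
    (f : ℕ → Polynomial F)
    (hf : ∀ i, 1 ≤ i → i ≤ s - 1 → IsPrimitivePoly (f i) (i * k + h))
    (r : ℕ) (hr : 0 < r) (t : Fin r → ℕ) (ht : StrictMono t)
    (htmem : ∀ i, t i ∈ longType s k h) :
    IsFlagCode t (flagCode s k h f t) ∧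
    IsCardinalityConsistent (flagCode s k h f t) ∧
    (flagCode s k h f t).ncard = (fullFlagCode s k h f).ncard ∧
    (fullFlagCode s k h f).ncard = (subspaceCode s k h f).ncard ∧
    (subspaceCode s k h f).ncard =
      (∑ i ∈ Finset.Icc 1 (s - 1), Fintype.card F ^ (i * k + h)) + 1 ∧
    HasMinDist (flagCode s k h f t)
      ((∑ i with t i ≤ k, 2 * t i) +
        (∑ i with k < t i ∧ s * k + h - k ≤ t i, 2 * (s * k + h - t i)) +
        (∑ i with k < t i ∧ t i < s * k + h - k, 2 * k)) := by
  have hk : 0 < k := by omega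
  have h2 := Nat.mul_le_mul_right k hs
  -- The full type may leave `longType`, but its first component, of dimension 1, already determines
  -- the generator matrix.
  have hfull : (fullFlagCode s k h f).ncard = Nat.card (GenIndex s k h f) :=
    ncard_flagCode hs hs4 hk hf (i := ⟨0, by omega⟩) (Or.inl ⟨le_rfl, by simp only; omega⟩)
  have hcode := ncard_flagCode hs hs4 hk hf (htmem ⟨0, hr⟩)
  have hsub := ncard_subspaceCode hs hs4 hk hf
  refine ⟨isFlagCode_flagCode hs hk hf ht htmem, fun i => ?_, hcode.trans hfull.symm,
    hfull.trans hsub.symm, hsub.trans (card_genIndex hk hf), ?_⟩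
  · rw [ncard_projectedCode hs hs4 hk hf (htmem i), hcode]
  · rw [← sum_componentDist]
    exact hasMinDist_flagCode hs hs4 hk hf hr htmem
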